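/- Let $q$ be a prime power and $n\ge 3$. A matrix $X\in M(n,q)$, the algebra of $n\times n$ matrices over $\mathbb F_q$, acts by right multiplication on the space $V=\mathbb F_q^{1\times n}$ of row vectors. For a monic irreducible divisor $g$ of the characteristic polynomial $c_X(t)$, let $V(g)=\ker g(X)^{\nu}$ be the $g$-primary component of $V$, where $g^{\nu}$ is the highest power of $g$ dividing $c_X(t)$. Call $X$ \emph{uncyclic} if $V(g)$ is not a cyclic $\mathbb F_q[X]$-module (that is, not of the form $v\,\mathbb F_q[X]$ with $v\in V(g)$) for every monic irreducible divisor $g$ of $c_X(t)$, and let $\mathrm{unc}(n,q)$ be the number of uncyclic matrices in $M(n,q)$. (a) For all prime powers $q\ge 2$, $$q^{-n-1}\left(1+\left(\tfrac{n-1}{2}\right)q^{-1}-q^{-3}\right)\le\frac{\mathrm{unc}(n,q)}{q^{n^2}},$$ with strict inequality if $n\ge4$ and with equality if $n=3$. (b) If $q\ge4$, then $$\frac{\mathrm{unc}(n,q)}{q^{n^2}}<2q^{-1}\left(q^{-1}+q^{-2}+2q^{-3}\right)^n.$$ (c) Moreover $$\frac{\mathrm{unc}(n,2)}{2^{n^2}}<(0.915)(0.983)^n\qquad\text{and}\qquad\frac{\mathrm{unc}(n,3)}{3^{n^2}}<(0.52)(0.53)^n.$$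 -/

import Mathlib

open Polynomial

/-- The `g`-primary component `V(g) = ker g(X)^ν` of the space `V` of row vectors of length `n`, on
which the matrix `X` acts by right multiplication `v ↦ v X`; here `ν` is the exponent of `g` in
the characteristic polynomial of `X`. -/
noncomputable def primaryComponent {F : Type*} [Field F] {n : ℕ}
    (X : Matrix (Fin n) (Fin n) F) (g : F[X]) : Submodule F (Fin n → F) :=
  LinearMap.ker (aeval X.vecMulLinear (g ^ multiplicity g X.charpoly))

/-- `X` is `f`-cyclic relative to `g`: the restriction of `X` to the `g`-primary component `V(g)`
is cyclic, that is, `V(g) = v F[X]` for some vector `v` in `V(g)`. -/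
def IsFCyclicRel {F : Type*} [Field F] {n : ℕ}
    (X : Matrix (Fin n) (Fin n) F) (g : F[X]) : Prop :=
  ∃ v ∈ primaryComponent X g, ∀ w ∈ primaryComponent X g,
    ∃ p : F[X], aeval X.vecMulLinear p v = w

/-- `X` is uncyclic: for every monic irreducible divisor `g` of the characteristic polynomial,
the restriction of `X` to the `g`-primary component is not cyclic. -/
def IsUncyclic {F : Type*} [Field F] {n : ℕ} (X : Matrix (Fin n) (Fin n) F) : Prop :=
  ∀ g : F[X], g.Monic → Irreducible g → g ∣ X.charpoly → ¬ IsFCyclicRel X g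

/-- The number of uncyclic `n × n` matrices over `F`. -/
noncomputable def unc (n : ℕ) (F : Type*) [Field F] [Fintype F] : ℕ :=
  Nat.card {X : Matrix (Fin n) (Fin n) F // IsUncyclic X}

/-! ### Fibre counting and the order of the general linear group. -/

section Counting

/-! By Fitting's lemma an endomorphism splits into a part on which `g` is nilpotent and a part on
which `g` is invertible, and every intertwiner respects the splitting. Hence counts divided by the
order of `GL_n` multiply: the generating function of these ratios for uncyclic endomorphisms is a
product, over monic irreducible `g`, of local series with coefficients `primaryRatio g k`.
`uncyclicRatio_insert` adjoins one factor.

The local coefficients come from counting pairs (X, v), where v is a vector of known order under X.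
With y = q^(-deg g) and m ≥ 1, the coefficient at m deg g is y^m times the gap 1/((1-y)...(1-y^m)) -
1/(1-y), the subtracted term being the cyclic endomorphisms (`primaryRatio_mul_natDegree`). The gap
vanishes at m = 1, which is why uncyclic matrices are rare.

Lower bound: keep only the endomorphisms with one or two eigenvalues, all in the field
(`le_uncyclicRatio_linear`, `euler_mul_lower_bound`). For n = 3 nothing is lost, since the upper
recursion gives the same value (`scaledRatio_three`).

Upper bound: let U n be q^n times the ratio for uncyclic endomorphisms. Splitting off one `g` at a
time bounds U n by the sum over `g` and m ≥ 2 of gap times U (n - m deg g) (`scaledRatio_le`). For q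
≥ 3 one gap bound per degree gives U n ≤ e (U 0 + ... + U (n-2)), hence growth at most like ρ^n with
e = ρ^2 - ρ (`unc_div_le`). For q = 2 this is too wasteful; there the first gaps are kept exactly
and U n ≤ 1.966^n follows by induction, because the weighted total of all gaps is at most 1
(`binaryWeight_total`). -/

lemma Nat.card_eq_mul_of_card_fiber {α β : Type*} [Finite α] (f : α → β)
    (hf : Function.Surjective f) (c : ℕ) (h : ∀ b, Nat.card {a // f a = b} = c) :
    Nat.card α = Nat.card β * c := by
  have : Finite β := Finite.of_surjective f hf
  have := Fintype.ofFinite β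
  rw [Nat.card_congr (Equiv.sigmaFiberEquiv f).symm, Nat.card_sigma]
  simp [h]

/-- The order of the general linear group of rank `n` over `F`. -/
noncomputable def glCard (F : Type*) [Field F] (n : ℕ) : ℕ :=
  Nat.card ((Fin n → F) ≃ₗ[F] (Fin n → F))

variable {F : Type*} [Field F]

lemma card_linearEquiv {V W : Type*} [AddCommGroup V] [Module F V] [FiniteDimensional F V]
    [AddCommGroup W] [Module F W] [FiniteDimensional F W] {n : ℕ}
    (hV : Module.finrank F V = n) (hW : Module.finrank F W = n) :
    Nat.card (V ≃ₗ[F] W) = glCard F n := by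
  let e : V ≃ₗ[F] (Fin n → F) := LinearEquiv.ofFinrankEq _ _ (by simp [hV])
  let e' : W ≃ₗ[F] (Fin n → F) := LinearEquiv.ofFinrankEq _ _ (by simp [hW])
  refine Nat.card_congr ⟨fun φ => e.symm.trans (φ.trans e'), fun φ => e.trans (φ.trans e'.symm), ?_, ?_⟩
  · intro φ; ext; simp
  · intro φ; ext; simp

variable [Finite F]

lemma finite_linearMap (V W : Type*) [AddCommGroup V] [Module F V] [FiniteDimensional F V]
    [AddCommGroup W] [Module F W] [FiniteDimensional F W] : Finite (V →ₗ[F] W) :=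
  Module.finite_of_finite F

lemma finite_linearEquiv (V W : Type*) [AddCommGroup V] [Module F V] [FiniteDimensional F V]
    [AddCommGroup W] [Module F W] [FiniteDimensional F W] : Finite (V ≃ₗ[F] W) := by
  have := finite_linearMap (F := F) V W
  exact Finite.of_injective (fun e : V ≃ₗ[F] W => (e : V →ₗ[F] W)) LinearEquiv.toLinearMap_injective

lemma glCard_pos (n : ℕ) : 0 < glCard F n := by
  have := finite_linearEquiv (F := F) (Fin n → F) (Fin n → F)
  exact Nat.card_pos

lemma glCard_eq (n : ℕ) :
    glCard F n = ∏ i : Fin n, (Nat.card F ^ n - Nat.card F ^ (i : ℕ)) := by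
  have := Fintype.ofFinite F
  rw [Nat.card_eq_fintype_card, ← Matrix.card_GL_field]
  exact Nat.card_congr ((LinearMap.GeneralLinearGroup.generalLinearEquiv F (Fin n → F)).symm.trans
    (Matrix.GeneralLinearGroup.toLin (n := Fin n) (R := F)).symm).toEquiv

end Counting

/-! ### Intertwiners between nilpotent and invertible parts. -/

section Decomposition

open LinearMap Module

variable {F : Type*} [Field F]

lemma aeval_comp_of_semiconj {V W : Type*} [AddCommGroup V] [Module F V] [AddCommGroup W]
    [Module F W] {A : End F V} {B : End F W} {φ : V →ₗ[F] W} (h : φ ∘ₗ A = B ∘ₗ φ) (p : F[X]) :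
    φ ∘ₗ aeval A p = aeval B p ∘ₗ φ := by
  have hx : ∀ x, φ (A x) = B (φ x) := fun x => LinearMap.congr_fun h x
  induction p using Polynomial.induction_on with
  | C a => ext x; simp [Algebra.algebraMap_eq_smul_one]
  | add p q hp hq => simp only [map_add, LinearMap.comp_add, LinearMap.add_comp, hp, hq]
  | monomial n a hn =>
    ext x
    have := LinearMap.congr_fun hn (A x)
    simpa [pow_succ, hx] using this

lemma pow_comp_of_semiconj {V W : Type*} [AddCommGroup V] [Module F V] [AddCommGroup W]
    [Module F W] {A : End F V} {B : End F W} {φ : V →ₗ[F] W} (h : φ ∘ₗ A = B ∘ₗ φ) (n : ℕ) :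
    φ ∘ₗ (A ^ n) = (B ^ n) ∘ₗ φ := by
  simpa using aeval_comp_of_semiconj h (X ^ n)

/-- A homomorphism from a module on which `g` acts nilpotently to one on which `g` acts
injectively is zero. -/
lemma eq_zero_of_semiconj_nilpotent_injective {V W : Type*} [AddCommGroup V] [Module F V]
    [AddCommGroup W] [Module F W] {A : End F V} {B : End F W} {φ : V →ₗ[F] W} {g : F[X]}
    (h : φ ∘ₗ A = B ∘ₗ φ) (hA : IsNilpotent (aeval A g)) (hB : ker (aeval B g) = ⊥) : φ = 0 := by
  obtain ⟨n, hn⟩ := hA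
  have h1 := pow_comp_of_semiconj (aeval_comp_of_semiconj h g) n
  rw [hn, LinearMap.comp_zero] at h1
  have hinj : Function.Injective ((aeval B g) ^ n) := by
    rw [Module.End.coe_pow]; exact (LinearMap.ker_eq_bot.1 hB).iterate n
  ext x
  apply hinj
  simpa using (LinearMap.congr_fun h1 x).symm

/-- The dual vanishing statement: every vector of the source is g(A)^n of something, and g(B)^n = 0.
-/
lemma eq_zero_of_semiconj_surjective_nilpotent {V W : Type*} [AddCommGroup V] [Module F V]
    [AddCommGroup W] [Module F W] {A : End F V} {B : End F W} {φ : V →ₗ[F] W} {g : F[X]}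
    (h : φ ∘ₗ A = B ∘ₗ φ) (hB : IsNilpotent (aeval B g))
    (hA : Function.Surjective (aeval A g)) : φ = 0 := by
  obtain ⟨n, hn⟩ := hB
  have h1 := pow_comp_of_semiconj (aeval_comp_of_semiconj h g) n
  rw [hn, LinearMap.zero_comp] at h1
  have hsurj : Function.Surjective ((aeval A g) ^ n) := by
    rw [Module.End.coe_pow]; exact hA.iterate n
  ext x
  obtain ⟨y, rfl⟩ := hsurj x
  simpa using LinearMap.congr_fun h1 y

section Transport

variable {V W : Type*} [AddCommGroup V] [Module F V] [AddCommGroup W] [Module F W]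

lemma aeval_linearEquiv_conj (φ : V ≃ₗ[F] W) (A : End F V) (p : F[X]) :
    aeval (φ.conj A) p = φ.conj (aeval A p) :=
  (Polynomial.aeval_algHom_apply (φ.conjAlgEquiv F).toAlgHom A p)

lemma finrank_ker_conj (φ : V ≃ₗ[F] W) (A : End F V) :
    finrank F (ker (φ.conj A)) = finrank F (ker A) := by
  have : ker (φ.conj A) = (ker A).map (φ : V →ₗ[F] W) := by
    ext x
    simp only [LinearMap.mem_ker, LinearEquiv.conj_apply, LinearMap.comp_apply,
      LinearEquiv.coe_coe, Submodule.mem_map, map_eq_zero_iff φ φ.injective]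
    exact ⟨fun h => ⟨φ.symm x, h, by simp⟩, by rintro ⟨y, hy, rfl⟩; simpa using hy⟩
  rw [this, LinearEquiv.finrank_map_eq]

lemma isNilpotent_conj_iff (φ : V ≃ₗ[F] W) (A : End F V) :
    IsNilpotent (φ.conj A) ↔ IsNilpotent A :=
  IsNilpotent.map_iff (f := φ.conjAlgEquiv F) (φ.conjAlgEquiv F).injective

lemma aeval_prodMap (A : End F V) (B : End F W) (p : F[X]) :
    aeval (A.prodMap B) p = (aeval A p).prodMap (aeval B p) :=
  (Polynomial.aeval_algHom_apply (LinearMap.prodMapAlgHom F V W) (A, B) p).trans (by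
    have : aeval (A, B) p = (aeval A p, aeval B p) := by
      exact Prod.ext (Polynomial.aeval_algHom_apply (AlgHom.fst F (End F V) (End F W)) (A, B) p).symm
        (Polynomial.aeval_algHom_apply (AlgHom.snd F (End F V) (End F W)) (A, B) p).symm
    rw [this]; rfl)

end Transport

/-- Each off-diagonal block intertwines a part where `g` is nilpotent with one where `g` is
injective, or the reverse. In the reverse case finite dimension turns injectivity into surjectivity.
-/
lemma off_diagonal_eq_zero_of_semiconj {V W V' W' : Type*} [AddCommGroup V] [Module F V]
    [AddCommGroup W] [Module F W] [AddCommGroup V'] [Module F V'] [AddCommGroup W'] [Module F W']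
    [FiniteDimensional F W] {g : F[X]}
    {A : End F V} {B : End F W} {A' : End F V'} {B' : End F W'}
    (hA : IsNilpotent (aeval A g)) (hA' : IsNilpotent (aeval A' g))
    (hB : ker (aeval B g) = ⊥) (hB' : ker (aeval B' g) = ⊥)
    (θ : (V × W) →ₗ[F] (V' × W')) (h : ∀ x, θ (A.prodMap B x) = A'.prodMap B' (θ x)) :
    (∀ v, (θ (v, 0)).2 = 0) ∧ ∀ w, (θ (0, w)).1 = 0 := by
  have h1 : (snd F V' W' ∘ₗ θ ∘ₗ inl F V W) = 0 := by
    refine eq_zero_of_semiconj_nilpotent_injective (A := A) (B := B') (g := g) ?_ hA hB'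
    refine LinearMap.ext fun v => ?_
    simpa using congrArg Prod.snd (h (v, 0))
  have h2 : (fst F V' W' ∘ₗ θ ∘ₗ inr F V W) = 0 := by
    refine eq_zero_of_semiconj_surjective_nilpotent (A := B) (B := A') (g := g) ?_ hA'
      (LinearMap.injective_iff_surjective.1 (LinearMap.ker_eq_bot.1 hB))
    refine LinearMap.ext fun v => ?_
    simpa using congrArg Prod.fst (h (0, v))
  exact ⟨fun v => LinearMap.congr_fun h1 v, fun w => LinearMap.congr_fun h2 w⟩

/-- An intertwiner between two direct sums of a part where `g` acts nilpotently and a part where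
`g` acts bijectively is block diagonal. -/
lemma exists_prodCongr_of_semiconj {V W V' W' : Type*} [AddCommGroup V] [Module F V]
    [AddCommGroup W] [Module F W] [AddCommGroup V'] [Module F V'] [AddCommGroup W'] [Module F W']
    [FiniteDimensional F W] [FiniteDimensional F W'] {g : F[X]}
    {A : End F V} {B : End F W} {A' : End F V'} {B' : End F W'}
    (hA : IsNilpotent (aeval A g)) (hA' : IsNilpotent (aeval A' g))
    (hB : ker (aeval B g) = ⊥) (hB' : ker (aeval B' g) = ⊥)
    (θ : (V × W) ≃ₗ[F] (V' × W')) (h : θ.conj (A.prodMap B) = A'.prodMap B') :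
    ∃ (α : V ≃ₗ[F] V') (β : W ≃ₗ[F] W'), θ = α.prodCongr β ∧ α.conj A = A' ∧ β.conj B = B' := by
  have hx : ∀ x, θ (A.prodMap B x) = A'.prodMap B' (θ x) := by
    intro x
    have := LinearMap.congr_fun h (θ x)
    simpa [LinearEquiv.conj_apply] using this
  have hy : ∀ y, θ.symm (A'.prodMap B' y) = A.prodMap B (θ.symm y) := by
    intro y
    rw [θ.symm_apply_eq, hx, θ.apply_symm_apply]
  obtain ⟨k1, k2⟩ := off_diagonal_eq_zero_of_semiconj hA hA' hB hB' θ.toLinearMap hx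
  obtain ⟨k3, k4⟩ := off_diagonal_eq_zero_of_semiconj hA' hA hB' hB θ.symm.toLinearMap hy
  simp only [LinearEquiv.coe_coe] at k1 k2 k3 k4
  have e1 : ∀ v, θ (v, 0) = ((θ (v, 0)).1, 0) := fun v => Prod.ext rfl (k1 v)
  have e2 : ∀ v, θ (0, v) = (0, (θ (0, v)).2) := fun v => Prod.ext (k2 v) rfl
  have e3 : ∀ v, θ.symm (v, 0) = ((θ.symm (v, 0)).1, 0) := fun v => Prod.ext rfl (k3 v)
  have e4 : ∀ v, θ.symm (0, v) = (0, (θ.symm (0, v)).2) := fun v => Prod.ext (k4 v) rfl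
  let α : V ≃ₗ[F] V' := LinearEquiv.ofLinearMap (fst F V' W' ∘ₗ θ.toLinearMap ∘ₗ inl F V W)
    (fst F V W ∘ₗ θ.symm.toLinearMap ∘ₗ inl F V' W')
    (by refine LinearMap.ext fun v => ?_; simp [← e3]) (by refine LinearMap.ext fun v => ?_; simp [← e1])
  let β : W ≃ₗ[F] W' := LinearEquiv.ofLinearMap (snd F V' W' ∘ₗ θ.toLinearMap ∘ₗ inr F V W)
    (snd F V W ∘ₗ θ.symm.toLinearMap ∘ₗ inr F V' W')
    (by refine LinearMap.ext fun v => ?_; simp [← e4]) (by refine LinearMap.ext fun v => ?_; simp [← e2])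
  have hα : ∀ v, α v = (θ (v, 0)).1 := fun v => rfl
  have hβ : ∀ v, β v = (θ (0, v)).2 := fun v => rfl
  refine ⟨α, β, ?_, ?_, ?_⟩
  · refine LinearEquiv.ext fun x => ?_
    obtain ⟨v, w⟩ := x
    have : ((v, w) : V × W) = (v, 0) + (0, w) := by simp
    rw [this, map_add, e1, e2]
    simp [hα, hβ]
  · refine LinearMap.ext fun v => ?_
    obtain ⟨v, rfl⟩ := α.surjective v
    have := congrArg Prod.fst (hx (v, 0))
    rw [LinearEquiv.conj_apply_apply, LinearEquiv.symm_apply_apply]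
    simpa [hα] using this
  · refine LinearMap.ext fun v => ?_
    obtain ⟨v, rfl⟩ := β.surjective v
    have := congrArg Prod.snd (hx (0, v))
    rw [LinearEquiv.conj_apply_apply, LinearEquiv.symm_apply_apply]
    simpa [hβ] using this

end Decomposition

/-! ### Uncyclicity through kernel dimensions, and the Fitting splitting. -/

section Decomposition

open LinearMap Module

variable {F : Type*} [Field F]

/-- The endomorphisms of `W` all of whose eigenvalue polynomials equal `g` (that is, on which `g`
is nilpotent) and which are zero or not cyclic. -/
def primaryNoncyclic (g : F[X]) (W : Type*) [AddCommGroup W] [Module F W] : Set (End F W) :=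
  {A | IsNilpotent (aeval A g) ∧ finrank F (ker (aeval A g)) ≠ g.natDegree}

/-- The endomorphisms of `W` such that every irreducible divisor of the characteristic polynomial
lies in `S`, and no primary component is cyclic. -/
def uncyclicIn (S : Set F[X]) (W : Type*) [AddCommGroup W] [Module F W] : Set (End F W) :=
  {A | ∀ h : F[X], h.Monic → Irreducible h →
    (h ∈ S → finrank F (ker (aeval A h)) ≠ h.natDegree) ∧
    (h ∉ S → finrank F (ker (aeval A h)) = 0)}

variable {V W : Type*} [AddCommGroup V] [Module F V] [AddCommGroup W] [Module F W]

lemma finrank_ker_aeval_conj (φ : V ≃ₗ[F] W) (A : End F V) (p : F[X]) :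
    finrank F (ker (aeval (φ.conj A) p)) = finrank F (ker (aeval A p)) := by
  rw [aeval_linearEquiv_conj, finrank_ker_conj]

lemma primaryNoncyclic_conj {g : F[X]} (φ : V ≃ₗ[F] W) {A : End F V} :
    φ.conj A ∈ primaryNoncyclic g W ↔ A ∈ primaryNoncyclic g V := by
  simp only [primaryNoncyclic, Set.mem_ofPred_eq, finrank_ker_aeval_conj]
  rw [aeval_linearEquiv_conj, isNilpotent_conj_iff]

lemma uncyclicIn_conj {S : Set F[X]} (φ : V ≃ₗ[F] W) {A : End F V} :
    φ.conj A ∈ uncyclicIn S W ↔ A ∈ uncyclicIn S V := by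
  simp only [uncyclicIn, Set.mem_ofPred_eq, finrank_ker_aeval_conj]

lemma isCoprime_of_monic_irreducible {g h : F[X]} (hg : g.Monic) (hg' : Irreducible g)
    (hh : h.Monic) (hh' : Irreducible h) (hne : h ≠ g) : IsCoprime g h := by
  rw [hg'.coprime_iff_not_dvd]
  intro hd
  exact hne (eq_of_monic_of_associated hg hh ((hg'.associated_of_dvd hh' hd))).symm

/-- Evaluate at `A` a Bézout identity for g^N and `h`, where g(A)^N = 0. -/
lemma ker_aeval_eq_bot_of_nilpotent {A : End F V} {g h : F[X]} (hA : IsNilpotent (aeval A g))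
    (hc : IsCoprime g h) : ker (aeval A h) = ⊥ := by
  obtain ⟨N, hN⟩ := hA
  obtain ⟨a, b, hab⟩ := hc.pow_left (m := N)
  rw [LinearMap.ker_eq_bot']
  intro v hv
  have := congrArg (fun p => aeval A p v) hab
  simpa [hN, hv] using this.symm

lemma finrank_ker_prodMap [FiniteDimensional F V] [FiniteDimensional F W]
    (A : End F V) (B : End F W) :
    finrank F (ker (A.prodMap B)) = finrank F (ker A) + finrank F (ker B) := by
  let e : ker (A.prodMap B) ≃ₗ[F] (ker A × ker B) :=
    { toFun := fun x => (⟨x.1.1, congrArg Prod.fst x.2⟩, ⟨x.1.2, congrArg Prod.snd x.2⟩)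
      invFun := fun y => ⟨(y.1.1, y.2.1), Prod.ext y.1.2 y.2.2⟩
      map_add' := fun _ _ => rfl
      map_smul' := fun _ _ => rfl
      left_inv := fun _ => rfl
      right_inv := fun _ => rfl }
  rw [e.finrank_eq, finrank_prod]

lemma finrank_ker_aeval_conj_prodMap [FiniteDimensional F V] [FiniteDimensional F W]
    {U : Type*} [AddCommGroup U] [Module F U] (φ : (V × W) ≃ₗ[F] U)
    (A : End F V) (B : End F W) (h : F[X]) :
    finrank F (ker (aeval (φ.conj (A.prodMap B)) h)) =
      finrank F (ker (aeval A h)) + finrank F (ker (aeval B h)) := by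
  rw [aeval_linearEquiv_conj, finrank_ker_conj, aeval_prodMap, finrank_ker_prodMap]

/-- Kernel dimensions add over the two blocks. At `g` only the first block contributes and at every
other irreducible only the second, so the condition decouples. -/
lemma conj_prodMap_mem_uncyclicIn_insert [FiniteDimensional F V] [FiniteDimensional F W]
    {U : Type*} [AddCommGroup U] [Module F U] (φ : (V × W) ≃ₗ[F] U)
    {A : End F V} {B : End F W} {g : F[X]} {S : Set F[X]} (hg : g.Monic) (hg' : Irreducible g)
    (hgS : g ∉ S) (hA : IsNilpotent (aeval A g)) (hB : ker (aeval B g) = ⊥) :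
    φ.conj (A.prodMap B) ∈ uncyclicIn (insert g S) U ↔
      A ∈ primaryNoncyclic g V ∧ B ∈ uncyclicIn S W := by
  have hA' : ∀ h : F[X], h.Monic → Irreducible h → h ≠ g → finrank F (ker (aeval A h)) = 0 := by
    intro h h1 h2 h3
    rw [ker_aeval_eq_bot_of_nilpotent hA (isCoprime_of_monic_irreducible hg hg' h1 h2 h3),
      finrank_bot]
  constructor
  · intro H
    refine ⟨⟨hA, ?_⟩, ?_⟩
    · have := (H g hg hg').1 (Set.mem_insert _ _)
      rwa [finrank_ker_aeval_conj_prodMap, hB, finrank_bot, add_zero] at this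
    · intro h h1 h2
      obtain ⟨H1, H2⟩ := H h h1 h2
      rw [finrank_ker_aeval_conj_prodMap] at H1 H2
      by_cases hne : h = g
      · subst hne
        exact ⟨fun h => absurd h hgS, fun _ => by rw [hB, finrank_bot]⟩
      · rw [hA' h h1 h2 hne, zero_add] at H1 H2
        exact ⟨fun hS => H1 (Set.mem_insert_of_mem _ hS),
          fun hS => H2 (by rw [Set.mem_insert_iff]; tauto)⟩
  · rintro ⟨H1, H2⟩ h h1 h2
    rw [finrank_ker_aeval_conj_prodMap]
    by_cases hne : h = g
    · subst hne
      refine ⟨fun _ => ?_, fun h => absurd (Set.mem_insert _ _) h⟩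
      rw [hB, finrank_bot, add_zero]
      exact H1.2
    · rw [hA' h h1 h2 hne, zero_add, Set.mem_insert_iff]
      have := H2 h h1 h2
      tauto

/-- Fitting's lemma for `g(X)`. -/
lemma exists_conj_prodMap_eq {U : Type*} [AddCommGroup U] [Module F U] [FiniteDimensional F U]
    (g : F[X]) (X : End F U) :
    ∃ (k l : ℕ) (φ : ((Fin k → F) × (Fin l → F)) ≃ₗ[F] U) (A : End F (Fin k → F))
      (B : End F (Fin l → F)), X = φ.conj (A.prodMap B) ∧ IsNilpotent (aeval A g) ∧
        ker (aeval B g) = ⊥ := by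
  -- N ≥ 1 is required so that the kernel of g(X) lies in the kernel of g(X)^N; this makes g(X)
  -- injective on the range part.
  obtain ⟨N, hN, hN1⟩ := ((aeval X g).eventually_isCompl_ker_pow_range_pow.and
    (Filter.eventually_ge_atTop 1)).exists
  set K := ker (aeval X g ^ N) with hK
  set L := range (aeval X g ^ N) with hL
  have hcomm : ∀ x, (aeval X g ^ N) (X x) = X ((aeval X g ^ N) x) := by
    intro x
    have : Commute (aeval X g ^ N) X := by
      rw [← map_pow]
      conv_rhs => rw [← aeval_X (R := F) X]
      exact (Commute.all (g ^ N) Polynomial.X).map (aeval X)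
    exact LinearMap.congr_fun this x
  have hXK : ∀ x ∈ K, X x ∈ K := by
    intro x hx
    rw [hK, LinearMap.mem_ker] at hx ⊢
    rw [hcomm, hx, map_zero]
  have hXL : ∀ x ∈ L, X x ∈ L := by
    rintro _ ⟨y, rfl⟩
    exact ⟨X y, hcomm y⟩
  let e := Submodule.prodEquivOfIsCompl K L hN
  let α : K ≃ₗ[F] (Fin (finrank F K) → F) := LinearEquiv.ofFinrankEq _ _ (by simp)
  let β : L ≃ₗ[F] (Fin (finrank F L) → F) := LinearEquiv.ofFinrankEq _ _ (by simp)
  have hsub : ∀ (p : Submodule F U) (hp : ∀ x ∈ p, X x ∈ p) (q : F[X]) (x : p),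
      ((aeval (X.restrict hp) q x : p) : U) = aeval X q x := by
    intro p hp q x
    exact (LinearMap.congr_fun (aeval_comp_of_semiconj (φ := p.subtype) (A := X.restrict hp)
      (B := X) (by ext; rfl) q) x)
  refine ⟨_, _, (α.prodCongr β).symm.trans e, α.conj (X.restrict hXK), β.conj (X.restrict hXL),
    ?_, ?_, ?_⟩
  · refine LinearMap.ext fun x => ?_
    obtain ⟨⟨a, b⟩, rfl⟩ := e.surjective x
    rw [LinearEquiv.conj_apply_apply]
    simp [e]
  · rw [aeval_linearEquiv_conj, isNilpotent_conj_iff]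
    refine ⟨N, LinearMap.ext fun x => Subtype.ext ?_⟩
    rw [← map_pow, hsub, map_pow]
    exact x.2
  · rw [← Submodule.finrank_eq_zero, aeval_linearEquiv_conj, finrank_ker_conj,
      Submodule.finrank_eq_zero, LinearMap.ker_eq_bot']
    intro x hx
    have h1 : aeval X g x = 0 := by rw [← hsub L hXL, hx]; rfl
    have h2 : (x : U) ∈ K := by
      obtain ⟨M, rfl⟩ := Nat.exists_eq_add_of_le' hN1
      rw [hK, LinearMap.mem_ker, pow_succ, Module.End.mul_apply, h1, map_zero]
    exact Subtype.ext (Submodule.disjoint_def.1 hN.disjoint _ h2 x.2)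

end Decomposition

/-! ### The convolution formula for the ratios. -/

section Decomposition

open LinearMap Module

variable {F : Type*} [Field F]

/-- The endomorphisms of `F ^ n` which, in suitable coordinates, are the direct sum of an
endomorphism of `F ^ k` in `primaryNoncyclic g` and one of `F ^ l` in `uncyclicIn S`. -/
def splitUncyclic (g : F[X]) (S : Set F[X]) (k l n : ℕ) : Set (End F (Fin n → F)) :=
  {X | ∃ (φ : ((Fin k → F) × (Fin l → F)) ≃ₗ[F] (Fin n → F)) (A : End F (Fin k → F))
    (B : End F (Fin l → F)), A ∈ primaryNoncyclic g _ ∧ B ∈ uncyclicIn S _ ∧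
      φ.conj (A.prodMap B) = X}

lemma ker_eq_bot_of_mem_uncyclicIn {W : Type*} [AddCommGroup W] [Module F W]
    [FiniteDimensional F W] {g : F[X]} {S : Set F[X]} (hg : g.Monic) (hg' : Irreducible g)
    (hgS : g ∉ S) {B : End F W} (hB : B ∈ uncyclicIn S W) : ker (aeval B g) = ⊥ :=
  Submodule.finrank_eq_zero.1 ((hB g hg hg').2 hgS)

/-- The triples (φ, A, B) map onto the split endomorphisms by conjugation, and each fibre is a
torsor under `GL_k` × `GL_l`. -/
lemma card_splitUncyclic [Finite F] {g : F[X]} {S : Set F[X]} (hg : g.Monic) (hg' : Irreducible g)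
    (hgS : g ∉ S) {k l n : ℕ} (hkl : k + l = n) :
    glCard F n * (Nat.card (primaryNoncyclic g (Fin k → F)) * Nat.card (uncyclicIn S (Fin l → F)))
      = Nat.card (splitUncyclic g S k l n) * (glCard F k * glCard F l) := by
  have hφ : Nat.card (((Fin k → F) × (Fin l → F)) ≃ₗ[F] (Fin n → F)) = glCard F n :=
    card_linearEquiv (by simp [hkl]) (by simp)
  rw [← hφ, ← Nat.card_prod, ← Nat.card_prod]
  have := finite_linearEquiv (F := F) ((Fin k → F) × (Fin l → F)) (Fin n → F)
  have := finite_linearMap (F := F) (Fin k → F) (Fin k → F)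
  have := finite_linearMap (F := F) (Fin l → F) (Fin l → F)
  let f : ((((Fin k → F) × (Fin l → F)) ≃ₗ[F] (Fin n → F)) × (primaryNoncyclic g (Fin k → F)) ×
      (uncyclicIn S (Fin l → F))) → splitUncyclic g S k l n :=
    fun z => ⟨z.1.conj (z.2.1.1.prodMap z.2.2.1), z.1, z.2.1.1, z.2.2.1, z.2.1.2, z.2.2.2, rfl⟩
  refine Nat.card_eq_mul_of_card_fiber f ?_ _ ?_
  · rintro ⟨X, φ, A, B, hA, hB, rfl⟩
    exact ⟨(φ, ⟨A, hA⟩, ⟨B, hB⟩), rfl⟩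
  · rintro ⟨X, φ, A, B, hA, hB, rfl⟩
    rw [glCard, glCard, ← Nat.card_prod ((Fin k → F) ≃ₗ[F] (Fin k → F)) ((Fin l → F) ≃ₗ[F] (Fin l → F))]
    symm
    -- Changing coordinates inside the two blocks and compensating in φ leaves the endomorphism
    -- unchanged; this is the action on the fibre.
    have hc : ∀ (α : (Fin k → F) ≃ₗ[F] (Fin k → F)) (β : (Fin l → F) ≃ₗ[F] (Fin l → F)),
        ((α.prodCongr β).symm.trans φ).conj ((α.conj A).prodMap (β.conj B)) =
          φ.conj (A.prodMap B) := by
      intro α β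
      refine LinearMap.ext fun x => ?_
      obtain ⟨⟨a, b⟩, rfl⟩ := φ.surjective x
      rw [LinearEquiv.conj_apply_apply]
      simp
    refine Nat.card_congr (Equiv.ofBijective (fun αβ =>
      ⟨((αβ.1.prodCongr αβ.2).symm.trans φ, ⟨αβ.1.conj A, (primaryNoncyclic_conj _).2 hA⟩,
        ⟨αβ.2.conj B, (uncyclicIn_conj _).2 hB⟩), Subtype.ext (hc _ _)⟩) ⟨?_, ?_⟩)
    · rintro ⟨α, β⟩ ⟨α', β'⟩ h
      have h1 : (α.prodCongr β).symm.trans φ = (α'.prodCongr β').symm.trans φ :=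
        congrArg (fun z => z.1.1) h
      have h2 : (α.prodCongr β).symm = (α'.prodCongr β').symm := by
        refine LinearEquiv.ext fun x => φ.injective ?_
        exact LinearEquiv.congr_fun h1 x
      have h3 : α.prodCongr β = α'.prodCongr β' := by
        rw [← LinearEquiv.symm_symm (α.prodCongr β), h2, LinearEquiv.symm_symm]
      refine Prod.ext (LinearEquiv.ext fun x => ?_) (LinearEquiv.ext fun x => ?_)
      · exact congrArg Prod.fst (LinearEquiv.congr_fun h3 (x, 0))
      · exact congrArg Prod.snd (LinearEquiv.congr_fun h3 (0, x))
    · rintro ⟨⟨ψ, ⟨A', hA'⟩, ⟨B', hB'⟩⟩, hz⟩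
      have hz' : ψ.conj (A'.prodMap B') = φ.conj (A.prodMap B) := congrArg Subtype.val hz
      -- Transitivity: two presentations of the same endomorphism differ by an intertwiner, which is
      -- block diagonal.
      obtain ⟨α, β, h1, h2, h3⟩ := exists_prodCongr_of_semiconj hA.1 hA'.1
        (ker_eq_bot_of_mem_uncyclicIn hg hg' hgS hB)
        (ker_eq_bot_of_mem_uncyclicIn hg hg' hgS hB') (φ.trans ψ.symm) (by
          refine LinearMap.ext fun x => ?_
          have := LinearMap.congr_fun hz' (ψ x)
          rw [LinearEquiv.conj_apply_apply, LinearEquiv.conj_apply_apply,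
            LinearEquiv.symm_apply_apply] at this
          rw [LinearEquiv.conj_apply_apply]
          simp only [LinearEquiv.trans_apply, LinearEquiv.trans_symm, LinearEquiv.symm_symm]
          rw [← this, LinearEquiv.symm_apply_apply])
      subst h2 h3
      refine ⟨(α, β), Subtype.ext (Prod.ext ?_ rfl)⟩
      change (α.prodCongr β).symm.trans φ = ψ
      rw [← h1]
      refine LinearEquiv.ext fun x => ?_
      simp

lemma splitUncyclic_subset {g : F[X]} {S : Set F[X]} (hg : g.Monic) (hg' : Irreducible g)
    (hgS : g ∉ S) (k l n : ℕ) :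
    splitUncyclic g S k l n ⊆ uncyclicIn (insert g S) (Fin n → F) := by
  rintro X ⟨φ, A, B, hA, hB, rfl⟩
  exact (conj_prodMap_mem_uncyclicIn_insert φ hg hg' hgS hA.1
    (ker_eq_bot_of_mem_uncyclicIn hg hg' hgS hB)).2 ⟨hA, hB⟩

lemma exists_mem_splitUncyclic {g : F[X]} {S : Set F[X]} (hg : g.Monic) (hg' : Irreducible g)
    (hgS : g ∉ S) {n : ℕ} {X : End F (Fin n → F)} (hX : X ∈ uncyclicIn (insert g S) (Fin n → F)) :
    ∃ k ≤ n, X ∈ splitUncyclic g S k (n - k) n := by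
  obtain ⟨k, l, φ, A, B, rfl, hA, hB⟩ := exists_conj_prodMap_eq g X
  obtain rfl : k + l = n := by simpa using φ.finrank_eq
  refine ⟨k, by omega, ?_⟩
  rw [Nat.add_sub_cancel_left]
  refine ⟨φ, A, B, ?_⟩
  · have := (conj_prodMap_mem_uncyclicIn_insert φ hg hg' hgS hA hB).1 hX
    exact ⟨this.1, this.2, rfl⟩

/-- Two splittings of one endomorphism are related by a block diagonal isomorphism, so the block
sizes agree and the classes are disjoint. -/
lemma eq_of_mem_splitUncyclic {g : F[X]} {S : Set F[X]} (hg : g.Monic) (hg' : Irreducible g)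
    (hgS : g ∉ S) {k l k' l' n : ℕ} {X : End F (Fin n → F)} (h : X ∈ splitUncyclic g S k l n)
    (h' : X ∈ splitUncyclic g S k' l' n) : k = k' ∧ l = l' := by
  obtain ⟨φ, A, B, hA, hB, rfl⟩ := h
  obtain ⟨ψ, A', B', hA', hB', hz'⟩ := h'
  obtain ⟨α, β, -⟩ := exists_prodCongr_of_semiconj hA.1 hA'.1
    (ker_eq_bot_of_mem_uncyclicIn hg hg' hgS hB)
    (ker_eq_bot_of_mem_uncyclicIn hg hg' hgS hB') (φ.trans ψ.symm) (by
      refine LinearMap.ext fun x => ?_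
      have := LinearMap.congr_fun hz' (ψ x)
      rw [LinearEquiv.conj_apply_apply, LinearEquiv.conj_apply_apply,
        LinearEquiv.symm_apply_apply] at this
      rw [LinearEquiv.conj_apply_apply]
      simp only [LinearEquiv.trans_apply, LinearEquiv.trans_symm, LinearEquiv.symm_symm]
      rw [← this, LinearEquiv.symm_apply_apply])
  exact ⟨by simpa using α.finrank_eq, by simpa using β.finrank_eq⟩

/-- The proportion `#(uncyclicIn S (F ^ n)) / #GL(n, F)`. -/
noncomputable def uncyclicRatio (S : Set F[X]) (n : ℕ) : ℝ :=
  Nat.card (uncyclicIn S (Fin n → F)) / glCard F n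

/-- The proportion `#(primaryNoncyclic g (F ^ n)) / #GL(n, F)`. -/
noncomputable def primaryRatio (g : F[X]) (n : ℕ) : ℝ :=
  Nat.card (primaryNoncyclic g (Fin n → F)) / glCard F n

/-- The coefficient form of multiplying the generating function by the local factor at `g`. Division
by the orders of the linear groups turns the orbit count into a plain convolution. -/
lemma uncyclicRatio_insert [Finite F] {g : F[X]} {S : Set F[X]} (hg : g.Monic) (hg' : Irreducible g)
    (hgS : g ∉ S) (n : ℕ) :
    uncyclicRatio (insert g S) n =
      ∑ k ∈ Finset.range (n + 1), primaryRatio g k * uncyclicRatio S (n - k) := by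
  have := finite_linearMap (F := F) (Fin n → F) (Fin n → F)
  let f : (Σ k : Fin (n + 1), splitUncyclic g S k (n - k) n) →
      uncyclicIn (insert g S) (Fin n → F) :=
    fun x => ⟨x.2.1, splitUncyclic_subset hg hg' hgS _ _ _ x.2.2⟩
  have hf : Function.Bijective f := by
    constructor
    · rintro ⟨k, X, hX⟩ ⟨k', X', hX'⟩ h
      obtain rfl : X = X' := congrArg Subtype.val h
      obtain rfl : k = k' := Fin.ext (eq_of_mem_splitUncyclic hg hg' hgS hX hX').1
      rfl
    · rintro ⟨X, hX⟩
      obtain ⟨k, hk, h⟩ := exists_mem_splitUncyclic hg hg' hgS hX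
      exact ⟨⟨⟨k, by omega⟩, X, h⟩, rfl⟩
  have hcard : (Nat.card (uncyclicIn (insert g S) (Fin n → F)) : ℝ) =
      ∑ k ∈ Finset.range (n + 1), (Nat.card (splitUncyclic g S k (n - k) n) : ℝ) := by
    rw [← Nat.card_congr (Equiv.ofBijective f hf), Nat.card_sigma, Nat.cast_sum,
      Fin.sum_univ_eq_sum_range (fun k => (Nat.card (splitUncyclic g S k (n - k) n) : ℝ))]
  rw [uncyclicRatio, hcard, Finset.sum_div]
  refine Finset.sum_congr rfl fun k hk => ?_
  have h := card_splitUncyclic hg hg' hgS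
    (show k + (n - k) = n by have := Finset.mem_range.1 hk; omega)
  have h' := congrArg (Nat.cast (R := ℝ)) h
  push_cast at h'
  have h0 : (0 : ℝ) < glCard F n := Nat.cast_pos.2 (glCard_pos n)
  have h1 : (0 : ℝ) < glCard F k := Nat.cast_pos.2 (glCard_pos k)
  have h2 : (0 : ℝ) < glCard F (n - k) := Nat.cast_pos.2 (glCard_pos (n - k))
  rw [primaryRatio, uncyclicRatio]
  field_simp
  linear_combination -h'

end Decomposition

/-! ### The cyclic module generated by a vector. -/

section CyclicModel

open LinearMap Module

variable {F : Type*} [Field F]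

/-- Multiplication by the root on `F[X] / (f)`. -/
noncomputable def mulRoot (f : F[X]) : End F (AdjoinRoot f) :=
  LinearMap.mulLeft F (AdjoinRoot.root f)

lemma aeval_mulRoot (f p : F[X]) (a : AdjoinRoot f) :
    aeval (mulRoot f) p a = AdjoinRoot.mk f p * a := by
  have h : aeval (mulRoot f) p = Algebra.lmul F (AdjoinRoot f) (aeval (AdjoinRoot.root f) p) :=
    Polynomial.aeval_algHom_apply (Algebra.lmul F (AdjoinRoot f)) (AdjoinRoot.root f) p
  rw [h, AdjoinRoot.aeval_eq]
  rfl

variable {V : Type*} [AddCommGroup V] [Module F V]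

/-- The map `F[X] / (f) → V` that sends the class of `p` to `p(X) v`, if `f(X) v = 0`. -/
noncomputable def orbitMap {f : F[X]} (hf : f.Monic) (X : End F V) (v : V) :
    AdjoinRoot f →ₗ[F] V :=
  (LinearMap.applyₗ v) ∘ₗ (aeval X).toLinearMap ∘ₗ (AdjoinRoot.modByMonicHom hf)

lemma orbitMap_mk {f : F[X]} (hf : f.Monic) {X : End F V} {v : V} (hv : aeval X f v = 0)
    (p : F[X]) : orbitMap hf X v (AdjoinRoot.mk f p) = aeval X p v := by
  have h : orbitMap hf X v (AdjoinRoot.mk f p) = aeval X (p %ₘ f) v := by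
    simp [orbitMap, AdjoinRoot.modByMonicHom_mk]
  rw [h]
  conv_rhs => rw [← modByMonic_add_div p f, mul_comm f]
  simp [hv]

lemma orbitMap_one {f : F[X]} (hf : f.Monic) {X : End F V} {v : V} (hv : aeval X f v = 0) :
    orbitMap hf X v 1 = v := by
  rw [← map_one (AdjoinRoot.mk f), orbitMap_mk hf hv]; simp

lemma orbitMap_mulRoot {f : F[X]} (hf : f.Monic) {X : End F V} {v : V} (hv : aeval X f v = 0)
    (a : AdjoinRoot f) : orbitMap hf X v (mulRoot f a) = X (orbitMap hf X v a) := by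
  obtain ⟨p, rfl⟩ := AdjoinRoot.mk_surjective a
  have : mulRoot f (AdjoinRoot.mk f p) = AdjoinRoot.mk f (Polynomial.X * p) := by
    simp [mulRoot]
  rw [this, orbitMap_mk hf hv, orbitMap_mk hf hv]
  simp

/-- By Bézout the gcd of `p` and g^(k+1) also annihilates `v`. It is associated to some g^j, and j ≤
k would contradict the choice of k. -/
lemma pow_dvd_of_aeval_apply_eq_zero {g : F[X]} (hg' : Irreducible g) {k : ℕ} {X : End F V}
    {v : V} (hv : aeval X (g ^ (k + 1)) v = 0) (hv' : aeval X (g ^ k) v ≠ 0) {p : F[X]}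
    (hp : aeval X p v = 0) : g ^ (k + 1) ∣ p := by
  classical
  obtain ⟨j, hj, hassoc⟩ := (dvd_prime_pow hg'.prime _).1 (EuclideanDomain.gcd_dvd_right p (g ^ (k + 1)))
  have hgcd : aeval X (EuclideanDomain.gcd p (g ^ (k + 1))) v = 0 := by
    rw [EuclideanDomain.gcd_eq_gcd_ab, mul_comm p, mul_comm (g ^ (k + 1))]
    simp only [map_add, map_mul, LinearMap.add_apply, Module.End.mul_apply, hp, hv, map_zero,
      add_zero]
  rcases Nat.lt_or_ge k j with h | h
  · obtain rfl : j = k + 1 := by omega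
    exact hassoc.symm.dvd.trans (EuclideanDomain.gcd_dvd_left _ _)
  · obtain ⟨r, hr⟩ := hassoc.dvd.trans (pow_dvd_pow g h)
    exact absurd (by rw [hr, mul_comm, map_mul, Module.End.mul_apply, hgcd, map_zero]) hv'

lemma orbitMap_injective {g : F[X]} (hg : g.Monic) (hg' : Irreducible g) {k : ℕ} {X : End F V}
    {v : V} (hv : aeval X (g ^ (k + 1)) v = 0) (hv' : aeval X (g ^ k) v ≠ 0) :
    Function.Injective (orbitMap (hg.pow (k + 1)) X v) := by
  rw [injective_iff_map_eq_zero]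
  intro a ha
  obtain ⟨p, rfl⟩ := AdjoinRoot.mk_surjective a
  rw [orbitMap_mk _ hv] at ha
  exact AdjoinRoot.mk_eq_zero.2 (pow_dvd_of_aeval_apply_eq_zero hg' hv hv' ha)

lemma finrank_adjoinRoot {f : F[X]} (hf : f.Monic) : finrank F (AdjoinRoot f) = f.natDegree := by
  rw [(AdjoinRoot.powerBasis' hf).finrank, AdjoinRoot.powerBasis'_dim]

/-- Supplies coordinates in which the cyclic submodule generated by a vector is the second factor.
-/
lemma exists_linearEquiv_extending {W A : Type*} [AddCommGroup W] [Module F W]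
    [FiniteDimensional F W] [AddCommGroup A] [Module F A] [FiniteDimensional F A]
    [FiniteDimensional F V] {ι : A →ₗ[F] V} (hι : Function.Injective ι)
    (h : finrank F W + finrank F A = finrank F V) :
    ∃ φ : (W × A) ≃ₗ[F] V, ∀ a, φ (0, a) = ι a := by
  obtain ⟨q, hq⟩ := (range ι).exists_isCompl
  let e := LinearEquiv.ofInjective ι hι
  have h1 := Submodule.finrank_add_eq_of_isCompl hq
  have h2 := e.finrank_eq
  let e' : W ≃ₗ[F] q := LinearEquiv.ofFinrankEq _ _ (by omega)
  refine ⟨(e'.prodCongr e).trans (Submodule.prodEquivOfIsCompl q (range ι) hq.symm), fun a => ?_⟩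
  simp [e]

end CyclicModel

/-! ### Extensions of an endomorphism from a submodule. -/

section BlockTriangular

open LinearMap Module

variable {F : Type*} [Field F] {W A : Type*} [AddCommGroup W] [Module F W]
  [AddCommGroup A] [Module F A]

/-- The block triangular endomorphism `(w, a) ↦ (Y w, C a + N w)`. -/
def blockTri (C : End F A) (N : W →ₗ[F] A) (Y : End F W) : End F (W × A) :=
  (Y ∘ₗ fst F W A).prod (C ∘ₗ snd F W A + N ∘ₗ fst F W A)

@[simp] lemma blockTri_apply (C : End F A) (N : W →ₗ[F] A) (Y : End F W) (x : W × A) :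
    blockTri C N Y x = (Y x.1, C x.2 + N x.1) := rfl

/-- The endomorphisms of `W × A` that extend `C` on `A` and on which `g` is nilpotent. -/
def nilpotentExtensions (g : F[X]) (C : End F A) (W : Type*) [AddCommGroup W] [Module F W] :
    Set (End F (W × A)) :=
  {M | IsNilpotent (aeval M g) ∧ ∀ a, M (0, a) = (0, C a)}

/-- A power of `g` that vanishes on the quotient `W` moves everything into `A`, where a further
power vanishes. -/
lemma isNilpotent_aeval_blockTri {g : F[X]} {C : End F A} {N : W →ₗ[F] A} {Y : End F W}
    (hC : IsNilpotent (aeval C g)) :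
    IsNilpotent (aeval (blockTri C N Y) g) ↔ IsNilpotent (aeval Y g) := by
  have h1 : ∀ (p : F[X]) x, (aeval (blockTri C N Y) p x).1 = aeval Y p x.1 := fun p x =>
    LinearMap.congr_fun (aeval_comp_of_semiconj (φ := fst F W A) (A := blockTri C N Y) (B := Y)
      (LinearMap.ext fun x => rfl) p) x
  have h2 : ∀ (p : F[X]) a, aeval (blockTri C N Y) p (0, a) = (0, aeval C p a) := fun p a =>
    (LinearMap.congr_fun (aeval_comp_of_semiconj (φ := inr F W A) (A := C) (B := blockTri C N Y)
      (LinearMap.ext fun x => by simp) p) a).symm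
  constructor
  · rintro ⟨s, hs⟩
    refine ⟨s, LinearMap.ext fun w => ?_⟩
    rw [← map_pow] at hs ⊢
    rw [← h1 (g ^ s) (w, 0), hs]
    rfl
  · rintro ⟨s, hs⟩
    obtain ⟨t, ht⟩ := hC
    refine ⟨t + s, LinearMap.ext fun x => ?_⟩
    rw [pow_add, Module.End.mul_apply]
    rw [← map_pow] at hs ht
    have h3 : (aeval (blockTri C N Y) g ^ s) x = (0, ((aeval (blockTri C N Y) g ^ s) x).2) := by
      refine Prod.ext ?_ rfl
      rw [← map_pow, h1, hs]
      rfl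
    rw [h3, ← map_pow, ← map_pow, h2, ht]
    rfl

lemma card_nilpotentExtensions {g : F[X]} {C : End F A} (hC : IsNilpotent (aeval C g)) :
    Nat.card (nilpotentExtensions g C W) =
      Nat.card (W →ₗ[F] A) * Nat.card {Y : End F W // IsNilpotent (aeval Y g)} := by
  rw [← Nat.card_prod]
  symm
  refine Nat.card_congr (Equiv.ofBijective (fun z => ⟨blockTri C z.1 z.2.1,
    (isNilpotent_aeval_blockTri hC).2 z.2.2, fun a => by simp⟩) ⟨?_, ?_⟩)
  · rintro ⟨N, Y, hY⟩ ⟨N', Y', hY'⟩ h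
    have h' : blockTri C N Y = blockTri C N' Y' := congrArg Subtype.val h
    refine Prod.ext (LinearMap.ext fun w => ?_) (Subtype.ext (LinearMap.ext fun w => ?_))
    · simpa using congrArg Prod.snd (LinearMap.congr_fun h' (w, 0))
    · simpa using congrArg Prod.fst (LinearMap.congr_fun h' (w, 0))
  · rintro ⟨M, hM, hM'⟩
    have h : blockTri C (snd F W A ∘ₗ M ∘ₗ inl F W A) (fst F W A ∘ₗ M ∘ₗ inl F W A) = M := by
      refine LinearMap.ext fun x => ?_
      obtain ⟨w, a⟩ := x
      have : ((w, a) : W × A) = (w, 0) + (0, a) := by simp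
      conv_rhs => rw [this, map_add, hM']
      refine Prod.ext ?_ ?_ <;> simp [add_comm]
    refine ⟨(snd F W A ∘ₗ M ∘ₗ inl F W A, ⟨fst F W A ∘ₗ M ∘ₗ inl F W A, ?_⟩), Subtype.ext h⟩
    rwa [← isNilpotent_aeval_blockTri hC, h]

/-- Such a map is an arbitrary automorphism of `W` together with an arbitrary map from `W` to `A`.
The factor for the latter also occurs in `card_nilpotentExtensions`, and the two cancel in
`card_primaryPairs`. -/
lemma card_linearEquiv_fixing :
    Nat.card {θ : (W × A) ≃ₗ[F] (W × A) // ∀ a, θ (0, a) = (0, a)} =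
      Nat.card (W →ₗ[F] A) * Nat.card (W ≃ₗ[F] W) := by
  rw [← Nat.card_prod]
  symm
  refine Nat.card_congr (Equiv.ofBijective (fun z =>
    ⟨LinearEquiv.skewProd z.2 (LinearEquiv.refl F A) z.1, fun a => by simp⟩) ⟨?_, ?_⟩)
  · rintro ⟨N, Y⟩ ⟨N', Y'⟩ h
    have h' : ∀ x, LinearEquiv.skewProd Y (LinearEquiv.refl F A) N x =
      LinearEquiv.skewProd Y' (LinearEquiv.refl F A) N' x :=
        fun x => LinearEquiv.congr_fun (congrArg Subtype.val h) x
    refine Prod.ext (LinearMap.ext fun w => ?_) (LinearEquiv.ext fun w => ?_)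
    · simpa using congrArg Prod.snd (h' (w, 0))
    · simpa using congrArg Prod.fst (h' (w, 0))
  · rintro ⟨θ, hθ⟩
    have hθ' : ∀ a, θ.symm (0, a) = (0, a) := fun a => by rw [θ.symm_apply_eq, hθ]
    have hsplit : ∀ x : W × A, x = (x.1, 0) + (0, x.2) := fun x => by simp
    let D : W ≃ₗ[F] W := LinearEquiv.ofLinearMap (fst F W A ∘ₗ θ.toLinearMap ∘ₗ inl F W A)
      (fst F W A ∘ₗ θ.symm.toLinearMap ∘ₗ inl F W A)
      (by
        refine LinearMap.ext fun w => ?_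
        have := congrArg Prod.fst (congrArg θ (hsplit (θ.symm (w, 0))))
        rw [map_add, hθ] at this
        simpa using this.symm)
      (by
        refine LinearMap.ext fun w => ?_
        have := congrArg Prod.fst (congrArg θ.symm (hsplit (θ (w, 0))))
        rw [map_add, hθ'] at this
        simpa using this.symm)
    refine ⟨(snd F W A ∘ₗ θ.toLinearMap ∘ₗ inl F W A, D), Subtype.ext (LinearEquiv.ext fun x => ?_)⟩
    conv_rhs => rw [hsplit x, map_add, hθ]
    refine Prod.ext ?_ ?_
    · simp [D]
    · simp [add_comm]

end BlockTriangular

/-! ### Counting endomorphisms on which `g` is nilpotent. -/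

section PrimaryCount

open LinearMap Module

variable {F : Type*} [Field F]

/-- Pairs `(X, v)` such that `g(X)` is nilpotent and `v` has order exactly `g ^ (k + 1)`. -/
def primaryPairs (g : F[X]) (k : ℕ) (V : Type*) [AddCommGroup V] [Module F V] :
    Set (End F V × V) :=
  {z | IsNilpotent (aeval z.1 g) ∧ aeval z.1 (g ^ (k + 1)) z.2 = 0 ∧ aeval z.1 (g ^ k) z.2 ≠ 0}

/-- The proportion of the number of endomorphisms of `F ^ n` on which `g` is nilpotent to the
order of the general linear group. -/
noncomputable def nilpotentRatio (g : F[X]) (n : ℕ) : ℝ :=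
  Nat.card {Y : End F (Fin n → F) // IsNilpotent (aeval Y g)} / glCard F n

lemma isNilpotent_aeval_mulRoot (g : F[X]) (k : ℕ) :
    IsNilpotent (aeval (mulRoot (g ^ k)) g) := by
  refine ⟨k, LinearMap.ext fun a => ?_⟩
  rw [← map_pow, aeval_mulRoot, AdjoinRoot.mk_self, zero_mul]
  rfl

lemma finiteDimensional_adjoinRoot {f : F[X]} (hf : f.Monic) :
    FiniteDimensional F (AdjoinRoot f) :=
  (AdjoinRoot.powerBasis' hf).finite

lemma conj_mem_primaryPairs {g : F[X]} {k : ℕ} {W V : Type*} [AddCommGroup W] [Module F W]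
    [AddCommGroup V] [Module F V] (hg' : Irreducible g)
    (φ : (W × AdjoinRoot (g ^ (k + 1))) ≃ₗ[F] V)
    {M : End F (W × AdjoinRoot (g ^ (k + 1)))}
    (hM : M ∈ nilpotentExtensions g (mulRoot (g ^ (k + 1))) W) :
    (φ.conj M, φ (0, 1)) ∈ primaryPairs g k V := by
  have h : ∀ p : F[X], aeval (φ.conj M) p (φ (0, 1)) = φ (0, AdjoinRoot.mk _ p) := by
    intro p
    rw [aeval_linearEquiv_conj, LinearEquiv.conj_apply_apply, LinearEquiv.symm_apply_apply]
    have := LinearMap.congr_fun (aeval_comp_of_semiconj (φ := inr F W _)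
      (A := mulRoot (g ^ (k + 1))) (B := M) (LinearMap.ext fun a => by simp [hM.2]) p) 1
    rw [LinearMap.comp_apply, LinearMap.comp_apply, aeval_mulRoot, mul_one] at this
    exact congrArg φ this.symm
  refine ⟨?_, ?_, ?_⟩
  · rw [aeval_linearEquiv_conj, isNilpotent_conj_iff]; exact hM.1
  · rw [h, AdjoinRoot.mk_self]; exact map_zero φ
  · rw [h]
    intro h0
    have h1 := congrArg Prod.snd ((map_eq_zero_iff φ φ.injective).1 h0)
    have h2 : g ^ (k + 1) ∣ g ^ k := AdjoinRoot.mk_eq_zero.1 h1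
    have := (pow_dvd_pow_iff hg'.ne_zero hg'.not_isUnit).1 h2
    omega

/-- If `(φ.conj M, φ (0, 1)) = (X, v)` then `φ` is determined on the second factor. -/
lemma apply_inr_eq_orbitMap {g : F[X]} {k : ℕ} {W V : Type*} [AddCommGroup W] [Module F W]
    [AddCommGroup V] [Module F V] (hg : g.Monic) (hg' : Irreducible g)
    (φ : (W × AdjoinRoot (g ^ (k + 1))) ≃ₗ[F] V)
    {M : End F (W × AdjoinRoot (g ^ (k + 1)))}
    (hM : M ∈ nilpotentExtensions g (mulRoot (g ^ (k + 1))) W) (a : AdjoinRoot (g ^ (k + 1))) :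
    φ (0, a) = orbitMap (hg.pow (k + 1)) (φ.conj M) (φ (0, 1)) a := by
  obtain ⟨p, rfl⟩ := AdjoinRoot.mk_surjective a
  rw [orbitMap_mk _ (conj_mem_primaryPairs hg' φ hM).2.1,
    aeval_linearEquiv_conj, LinearEquiv.conj_apply_apply, LinearEquiv.symm_apply_apply]
  have := LinearMap.congr_fun (aeval_comp_of_semiconj (φ := inr F W _)
    (A := mulRoot (g ^ (k + 1))) (B := M) (LinearMap.ext fun a => by simp [hM.2]) p) 1
  rw [LinearMap.comp_apply, LinearMap.comp_apply, aeval_mulRoot, mul_one] at this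
  exact congrArg φ this

/-- A pair (X, v) is the same as an endomorphism that extends the cyclic model, with coordinates φ
carrying 1 to v, up to automorphisms that fix the model pointwise. -/
lemma card_primaryPairs [Finite F] {g : F[X]} (hg : g.Monic) (hg' : Irreducible g) {k b n : ℕ}
    (hn : b + (k + 1) * g.natDegree = n) :
    glCard F n * Nat.card {Y : End F (Fin b → F) // IsNilpotent (aeval Y g)} =
      Nat.card (primaryPairs g k (Fin n → F)) * glCard F b := by
  have hfd := finiteDimensional_adjoinRoot (hg.pow (k + 1))
  have hA : finrank F (AdjoinRoot (g ^ (k + 1))) = (k + 1) * g.natDegree := by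
    rw [finrank_adjoinRoot (hg.pow _), natDegree_pow]
  have hφ : Nat.card (((Fin b → F) × AdjoinRoot (g ^ (k + 1))) ≃ₗ[F] (Fin n → F)) = glCard F n :=
    card_linearEquiv (by simp [hA, hn]) (by simp)
  have := finite_linearMap (F := F) (Fin b → F) (AdjoinRoot (g ^ (k + 1)))
  have hpos : 0 < Nat.card ((Fin b → F) →ₗ[F] AdjoinRoot (g ^ (k + 1))) := Nat.card_pos
  have hb : Nat.card ((Fin b → F) ≃ₗ[F] (Fin b → F)) = glCard F b := rfl
  have := finite_linearEquiv (F := F) ((Fin b → F) × AdjoinRoot (g ^ (k + 1))) (Fin n → F)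
  have := finite_linearMap (F := F) ((Fin b → F) × AdjoinRoot (g ^ (k + 1)))
    ((Fin b → F) × AdjoinRoot (g ^ (k + 1)))
  refine Nat.eq_of_mul_eq_mul_left hpos ?_
  have key : Nat.card ((((Fin b → F) × AdjoinRoot (g ^ (k + 1))) ≃ₗ[F] (Fin n → F)) ×
      nilpotentExtensions g (mulRoot (g ^ (k + 1))) (Fin b → F)) =
      Nat.card (primaryPairs g k (Fin n → F)) *
        (Nat.card ((Fin b → F) →ₗ[F] AdjoinRoot (g ^ (k + 1))) * glCard F b) := by
    rw [← hb, ← card_linearEquiv_fixing]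
    let f : ((((Fin b → F) × AdjoinRoot (g ^ (k + 1))) ≃ₗ[F] (Fin n → F)) ×
        nilpotentExtensions g (mulRoot (g ^ (k + 1))) (Fin b → F)) →
        primaryPairs g k (Fin n → F) :=
      fun z => ⟨(z.1.conj z.2.1, z.1 (0, 1)), conj_mem_primaryPairs hg' z.1 z.2.2⟩
    have hf : Function.Surjective f := by
      rintro ⟨⟨X, v⟩, hX, hv, hv'⟩
      obtain ⟨φ, hφ⟩ := exists_linearEquiv_extending (W := Fin b → F)
        (orbitMap_injective hg hg' hv hv') (by simp [hA, hn])
      refine ⟨(φ, ⟨φ.symm.conj X, ?_, fun a => ?_⟩), ?_⟩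
      · rw [aeval_linearEquiv_conj, isNilpotent_conj_iff]; exact hX
      · rw [LinearEquiv.conj_apply_apply, LinearEquiv.symm_symm, hφ, ← orbitMap_mulRoot _ hv,
          ← hφ, LinearEquiv.symm_apply_apply]
      · refine Subtype.ext (Prod.ext (LinearMap.ext fun x => ?_) ?_)
        · change φ.conj (φ.symm.conj X) x = X x
          simp [LinearEquiv.conj_apply]
        · exact (hφ 1).trans (orbitMap_one _ hv)
    refine Nat.card_eq_mul_of_card_fiber f hf _ ?_
    intro z
    obtain ⟨⟨φ, M, hM⟩, rfl⟩ := hf z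
    symm
    refine Nat.card_congr (Equiv.ofBijective (fun θ => ⟨(θ.1.trans φ, ⟨θ.1.symm.conj M, ?_, ?_⟩),
      ?_⟩) ⟨?_, ?_⟩)
    · rw [aeval_linearEquiv_conj, isNilpotent_conj_iff]; exact hM.1
    · intro a
      rw [LinearEquiv.conj_apply_apply, LinearEquiv.symm_symm, θ.2, hM.2,
        LinearEquiv.symm_apply_eq, θ.2]
    · refine Subtype.ext (Prod.ext (LinearMap.ext fun x => ?_) ?_)
      · simp [f, LinearEquiv.conj_apply]
      · simp [f, θ.2]
    · rintro ⟨θ, hθ⟩ ⟨θ', hθ'⟩ h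
      have h1 : θ.trans φ = θ'.trans φ := congrArg (fun z => z.1.1) h
      exact Subtype.ext (LinearEquiv.ext fun x => φ.injective (LinearEquiv.congr_fun h1 x))
    · rintro ⟨⟨ψ, M', hM'⟩, hz⟩
      have h1 : ψ.conj M' = φ.conj M := congrArg (fun z => z.1.1) hz
      have h2 : ψ (0, 1) = φ (0, 1) := congrArg (fun z => z.1.2) hz
      refine ⟨⟨ψ.trans φ.symm, fun a => ?_⟩, Subtype.ext (Prod.ext ?_ (Subtype.ext ?_))⟩
      · rw [LinearEquiv.trans_apply, LinearEquiv.symm_apply_eq,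
          apply_inr_eq_orbitMap hg hg' φ hM, apply_inr_eq_orbitMap hg hg' ψ hM', h1, h2]
      · refine LinearEquiv.ext fun x => ?_
        change φ (φ.symm (ψ x)) = ψ x
        exact φ.apply_symm_apply _
      · refine LinearMap.ext fun x => ?_
        have := LinearMap.congr_fun h1 (ψ x)
        rw [LinearEquiv.conj_apply_apply, LinearEquiv.conj_apply_apply,
          LinearEquiv.symm_apply_apply] at this
        change (ψ.trans φ.symm).symm.conj M x = M' x
        rw [LinearEquiv.conj_apply_apply]
        simp [← this]
  rw [Nat.card_prod, hφ, card_nilpotentExtensions (isNilpotent_aeval_mulRoot g (k + 1))] at key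
  linear_combination key

lemma primaryPairs_eq_empty {g : F[X]} (hg : g.Monic) (hg' : Irreducible g) {k n : ℕ}
    (hn : n < (k + 1) * g.natDegree) : primaryPairs g k (Fin n → F) = ∅ := by
  refine Set.eq_empty_iff_forall_notMem.2 ?_
  rintro ⟨X, v⟩ ⟨-, hv, hv'⟩
  have h := LinearMap.finrank_le_finrank_of_injective (orbitMap_injective hg hg' hv hv')
  rw [finrank_adjoinRoot (hg.pow _), natDegree_pow, finrank_fin_fun] at h
  omega

/-- Every pair `(X, v)` with `g(X)` nilpotent and `v ≠ 0` has a well-defined order. -/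
lemma card_nilpotent_mul [Finite F] {g : F[X]} (hg : g.Monic) (hg' : Irreducible g) (n : ℕ) :
    Nat.card {Y : End F (Fin n → F) // IsNilpotent (aeval Y g)} * Nat.card F ^ n =
      Nat.card {Y : End F (Fin n → F) // IsNilpotent (aeval Y g)} +
        ∑ k ∈ Finset.range (n / g.natDegree), Nat.card (primaryPairs g k (Fin n → F)) := by
  have hd := hg'.natDegree_pos
  have hV : Nat.card (Fin n → F) = Nat.card F ^ n := by rw [Nat.card_fun, Nat.card_fin]
  have := finite_linearMap (F := F) (Fin n → F) (Fin n → F)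
  rw [← hV, ← Nat.card_prod, ← Fin.sum_univ_eq_sum_range
    (fun k => Nat.card (primaryPairs g k (Fin n → F))), ← Nat.card_sigma, ← Nat.card_sum]
  symm
  -- Pairs are sorted by the order of the vector: the left summand carries v = 0, the index k on the
  -- right means order g^(k+1).
  let f : ({Y : End F (Fin n → F) // IsNilpotent (aeval Y g)} ⊕
      (Σ k : Fin (n / g.natDegree), primaryPairs g k (Fin n → F))) →
      {Y : End F (Fin n → F) // IsNilpotent (aeval Y g)} × (Fin n → F) :=
    Sum.elim (fun Y => (Y, 0)) (fun z => (⟨z.2.1.1, z.2.2.1⟩, z.2.1.2))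
  have hne : ∀ {k} {z : End F (Fin n → F) × (Fin n → F)},
      z ∈ primaryPairs g k (Fin n → F) → z.2 ≠ 0 := by
    rintro k z ⟨-, -, h⟩ h0
    exact h (by rw [h0, map_zero])
  have hlt : ∀ {k k' : ℕ} {z : End F (Fin n → F) × (Fin n → F)},
      z ∈ primaryPairs g k (Fin n → F) → z ∈ primaryPairs g k' (Fin n → F) → ¬ k < k' := by
    rintro k k' z ⟨-, h1, -⟩ ⟨-, -, h2⟩ h
    obtain ⟨c, rfl⟩ := Nat.exists_eq_add_of_le h
    apply h2
    rw [show k.succ + c = c + (k + 1) by omega, pow_add, map_mul, Module.End.mul_apply, h1,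
      map_zero]
  refine Nat.card_congr (Equiv.ofBijective f ⟨?_, ?_⟩)
  · rintro (Y | ⟨k, ⟨X, v⟩, hX⟩) (Y' | ⟨k', ⟨X', v'⟩, hX'⟩) h
    · exact congrArg Sum.inl (congrArg Prod.fst h)
    · exact absurd (congrArg Prod.snd h).symm (hne hX')
    · exact absurd (congrArg Prod.snd h) (hne hX)
    · obtain rfl : X = X' := congrArg (fun z => z.1.1) h
      obtain rfl : v = v' := congrArg (fun z => z.2) h
      obtain rfl : k = k' := Fin.ext (le_antisymm (not_lt.1 (hlt hX' hX)) (not_lt.1 (hlt hX hX')))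
      rfl
  · rintro ⟨⟨X, hX⟩, v⟩
    by_cases hv : v = 0
    · exact ⟨Sum.inl ⟨X, hX⟩, by rw [hv]; rfl⟩
    · classical
      have hex : ∃ s, aeval X (g ^ s) v = 0 := by
        obtain ⟨s, hs⟩ := hX
        exact ⟨s, by rw [map_pow, hs]; rfl⟩
      have h1 := Nat.find_spec hex
      have h2 : Nat.find hex ≠ 0 := by
        intro h0
        rw [h0] at h1
        exact hv (by simpa using h1)
      obtain ⟨k, hk⟩ := Nat.exists_eq_succ_of_ne_zero h2
      have h3 : (X, v) ∈ primaryPairs g k (Fin n → F) := by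
        refine ⟨hX, ?_, ?_⟩
        · rw [hk] at h1; exact h1
        · exact Nat.find_min hex (by omega)
      have h4 : k < n / g.natDegree := by
        by_contra hcon
        rw [primaryPairs_eq_empty hg hg'
          (by rw [← Nat.div_lt_iff_lt_mul hd]; omega)] at h3
        exact h3
      exact ⟨Sum.inr ⟨⟨k, h4⟩, (X, v), h3⟩, rfl⟩

lemma nilpotentRatio_mul [Finite F] {g : F[X]} (hg : g.Monic) (hg' : Irreducible g) (n : ℕ) :
    nilpotentRatio g n * (Nat.card F : ℝ) ^ n = nilpotentRatio g n +
      ∑ k ∈ Finset.range (n / g.natDegree), nilpotentRatio g (n - (k + 1) * g.natDegree) := by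
  have hd := hg'.natDegree_pos
  have h := congrArg (Nat.cast (R := ℝ)) (card_nilpotent_mul hg hg' n)
  push_cast at h
  have h0 : (0 : ℝ) < glCard F n := Nat.cast_pos.2 (glCard_pos n)
  have h1 : ∀ k ∈ Finset.range (n / g.natDegree),
      (Nat.card (primaryPairs g k (Fin n → F)) : ℝ) =
        glCard F n * nilpotentRatio g (n - (k + 1) * g.natDegree) := by
    intro k hk
    have hk' : (k + 1) * g.natDegree ≤ n :=
      (Nat.le_div_iff_mul_le hd).1 (Finset.mem_range.1 hk)
    have h2 := congrArg (Nat.cast (R := ℝ)) (card_primaryPairs hg hg'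
      (show (n - (k + 1) * g.natDegree) + (k + 1) * g.natDegree = n by omega))
    push_cast at h2
    have h3 : (0 : ℝ) < glCard F (n - (k + 1) * g.natDegree) := Nat.cast_pos.2 (glCard_pos _)
    rw [nilpotentRatio]
    field_simp
    linear_combination -h2
  rw [Finset.sum_congr rfl h1, ← Finset.mul_sum] at h
  rw [nilpotentRatio]
  field_simp
  exact h

lemma nilpotentRatio_zero [Finite F] (g : F[X]) : nilpotentRatio g 0 = 1 := by
  have : Unique {Y : End F (Fin 0 → F) // IsNilpotent (aeval Y g)} :=
    { default := ⟨0, 1, Subsingleton.elim _ _⟩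
      uniq := fun _ => Subsingleton.elim _ _ }
  rw [nilpotentRatio, Nat.card_unique, glCard_eq]
  simp

lemma one_lt_natCard_pow [Finite F] {n : ℕ} (hn : n ≠ 0) : (1 : ℝ) < (Nat.card F : ℝ) ^ n :=
  one_lt_pow₀ (by exact_mod_cast Finite.one_lt_card) hn

/-- The recursion only involves indices that again fail to be multiples of the degree, so by
induction its sum vanishes, while q^n - 1 does not. -/
lemma nilpotentRatio_of_not_dvd [Finite F] {g : F[X]} (hg : g.Monic) (hg' : Irreducible g) {n : ℕ}
    (hn : ¬ g.natDegree ∣ n) : nilpotentRatio g n = 0 := by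
  have hd := hg'.natDegree_pos
  induction n using Nat.strong_induction_on with
  | _ n ih =>
    have h := nilpotentRatio_mul hg hg' n
    rw [Finset.sum_eq_zero] at h
    · have h0 : n ≠ 0 := by rintro rfl; exact hn (dvd_zero _)
      have h1 := one_lt_natCard_pow (F := F) h0
      have h2 : nilpotentRatio g n * ((Nat.card F : ℝ) ^ n - 1) = 0 := by linear_combination h
      rcases mul_eq_zero.1 h2 with h3 | h3
      · exact h3
      · linarith
    · intro k hk
      have hk' : (k + 1) * g.natDegree ≤ n :=
        (Nat.le_div_iff_mul_le hd).1 (Finset.mem_range.1 hk)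
      refine ih _ ?_ ?_
      · have : 0 < (k + 1) * g.natDegree := by positivity
        omega
      · intro hdvd
        exact hn ((Nat.dvd_sub_iff_left hk' (Dvd.intro_left _ rfl)).1 hdvd)

/-- The product `(1 - x) (1 - x ^ 2) ⋯ (1 - x ^ m)`. -/
noncomputable def euler (x : ℝ) (m : ℕ) : ℝ := ∏ i ∈ Finset.range m, (1 - x ^ (i + 1))

lemma euler_succ (x : ℝ) (m : ℕ) : euler x (m + 1) = euler x m * (1 - x ^ (m + 1)) :=
  Finset.prod_range_succ _ _

/-- The number of endomorphisms of `F ^ (m d)` with characteristic polynomial `g ^ m`, where `g`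
has degree `d`; for `g = X` this is the theorem of Fine and Herstein. -/
lemma nilpotentRatio_mul_natDegree [Finite F] {g : F[X]} (hg : g.Monic) (hg' : Irreducible g)
    (m : ℕ) : nilpotentRatio g (m * g.natDegree) =
      (((Nat.card F : ℝ) ^ g.natDegree)⁻¹) ^ m / euler (((Nat.card F : ℝ) ^ g.natDegree)⁻¹) m := by
  have hd := hg'.natDegree_pos
  set Q : ℝ := (Nat.card F : ℝ) ^ g.natDegree with hQ
  have hQ1 : 1 < Q := one_lt_natCard_pow hd.ne'
  have hrec : ∀ m, nilpotentRatio g (m * g.natDegree) * (Q ^ m - 1) =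
      ∑ i ∈ Finset.range m, nilpotentRatio g (i * g.natDegree) := by
    intro m
    have h := nilpotentRatio_mul hg hg' (m * g.natDegree)
    rw [Nat.mul_div_cancel _ hd, mul_comm m, pow_mul, ← hQ, mul_comm _ m] at h
    rw [← Finset.sum_range_reflect, mul_sub, h, mul_one, add_sub_cancel_left]
    refine Finset.sum_congr rfl fun i hi => ?_
    rw [← Nat.sub_mul, show m - (i + 1) = m - 1 - i by omega]
  induction m with
  | zero => simp [nilpotentRatio_zero, euler]
  | succ m ih =>
    have h1 := hrec (m + 1)
    -- Comparing the recursions at m + 1 and m telescopes the sum: a(m+1) (Q^(m+1) - 1) = a(m) Q^m.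
    rw [Finset.sum_range_succ, ← hrec m, ih] at h1
    have hQm : 1 < Q ^ (m + 1) := one_lt_pow₀ hQ1 (by omega)
    have h2 : (1 : ℝ) - Q⁻¹ ^ (m + 1) = (Q ^ (m + 1) - 1) / Q ^ (m + 1) := by
      rw [inv_pow]
      field_simp
    have h3 : Q ^ (m + 1) - 1 ≠ 0 := by linarith
    rw [eq_comm, euler_succ, h2, ← mul_left_inj' h3, h1]
    have : Q ≠ 0 := by linarith
    -- If the product vanished, both sides would be 0 because division by 0 gives 0; no positivity
    -- is needed.
    by_cases he : euler Q⁻¹ m = 0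
    · simp [he]
    · rw [inv_pow, inv_pow]
      field_simp
      ring

end PrimaryCount

/-! ### Counting cyclic primary endomorphisms, and the local coefficients. -/

section CyclicCount

open LinearMap Module

variable {F : Type*} [Field F]

variable {V : Type*} [AddCommGroup V] [Module F V]

lemma exists_order_of_mem {g : F[X]} {X : End F V} {p : Submodule F V} (hp : p ≠ ⊥) {s : ℕ}
    (hs : ∀ v ∈ p, aeval X (g ^ s) v = 0) :
    ∃ k, (∀ v ∈ p, aeval X (g ^ (k + 1)) v = 0) ∧ ∃ v ∈ p, aeval X (g ^ k) v ≠ 0 := by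
  classical
  have hex : ∃ s, ∀ v ∈ p, aeval X (g ^ s) v = 0 := ⟨s, hs⟩
  have h1 := Nat.find_spec hex
  have h2 : Nat.find hex ≠ 0 := by
    intro h0
    rw [h0] at h1
    exact hp ((Submodule.eq_bot_iff _).2 fun v hv => by simpa using h1 v hv)
  obtain ⟨k, hk⟩ := Nat.exists_eq_succ_of_ne_zero h2
  refine ⟨k, fun v hv => by rw [hk] at h1; exact h1 v hv, ?_⟩
  have := Nat.find_min hex (show k < Nat.find hex by omega)
  push Not at this
  exact this

variable [FiniteDimensional F V]

/-- Rank-nullity for `h` restricted to the kernel of the composite: its image lies in ker f and its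
kernel embeds in ker h. -/
lemma finrank_ker_comp_le (f h : End F V) :
    finrank F (ker (f * h)) ≤ finrank F (ker f) + finrank F (ker h) := by
  have hmaps : ∀ x ∈ ker (f * h), h x ∈ ker f := fun x hx => hx
  have h1 := (h.restrict hmaps).finrank_range_add_finrank_ker
  have h2 : finrank F (range (h.restrict hmaps)) ≤ finrank F (ker f) := Submodule.finrank_le _
  have h3 : finrank F (ker (h.restrict hmaps)) ≤ finrank F (ker h) := by
    refine LinearMap.finrank_le_finrank_of_injective
      (f := ((Submodule.subtype _) ∘ₗ (Submodule.subtype _)).codRestrict (ker h)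
        fun x => congrArg Subtype.val x.2) fun x y hxy => ?_
    have hxy' : (x.1.1 : V) = y.1.1 := congrArg (fun z : ker h => (z : V)) hxy
    exact Subtype.ext (Subtype.ext hxy')
  omega

lemma finrank_ker_pow_le (f : End F V) (j : ℕ) :
    finrank F (ker (f ^ j)) ≤ j * finrank F (ker f) := by
  induction j with
  | zero =>
    have : ker (f ^ 0) = ⊥ := LinearMap.ker_eq_bot.2 fun x y h => h
    rw [this, finrank_bot]
    exact Nat.zero_le _
  | succ j ih =>
    have := finrank_ker_comp_le (f ^ j) f
    rw [pow_succ, Nat.succ_mul]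
    omega

lemma le_finrank_of_order {g : F[X]} (hg : g.Monic) (hg' : Irreducible g) {k : ℕ} {X : End F V}
    {v : V} (hv : aeval X (g ^ (k + 1)) v = 0) (hv' : aeval X (g ^ k) v ≠ 0)
    (p : Submodule F V) (hp : ∀ q : F[X], aeval X q v ∈ p) :
    (k + 1) * g.natDegree ≤ finrank F p := by
  have h := orbitMap_injective hg hg' hv hv'
  rw [← natDegree_pow, ← finrank_adjoinRoot (hg.pow (k + 1))]
  refine LinearMap.finrank_le_finrank_of_injective
    (f := (orbitMap (hg.pow (k + 1)) X v).codRestrict p fun a => ?_) fun a b hab => ?_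
  · obtain ⟨q, rfl⟩ := AdjoinRoot.mk_surjective a
    rw [orbitMap_mk _ hv]
    exact hp q
  · exact h (congrArg Subtype.val hab)

lemma natDegree_le_finrank_ker {g : F[X]} (hg : g.Monic) (hg' : Irreducible g) {X : End F V}
    (h : ker (aeval X g) ≠ ⊥) : g.natDegree ≤ finrank F (ker (aeval X g)) := by
  obtain ⟨v, hv, hv0⟩ := Submodule.exists_mem_ne_zero_of_ne_bot h
  have := le_finrank_of_order hg hg' (k := 0) (X := X) (v := v) (by simpa using hv)
    (by simpa using hv0) (ker (aeval X g)) (fun q => by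
      rw [LinearMap.mem_ker, ← Module.End.mul_apply, ← map_mul, mul_comm, map_mul,
        Module.End.mul_apply, LinearMap.mem_ker.1 hv, map_zero])
  simpa using this

/-- For k ≥ 1 the vector g(X)v has order g^k, so the range of g(X) has dimension at least k deg g,
which leaves at most deg g for the kernel. -/
lemma finrank_ker_eq_of_mem_primaryPairs {g : F[X]} (hg : g.Monic) (hg' : Irreducible g) {k : ℕ}
    {X : End F V} {v : V} (h : (X, v) ∈ primaryPairs g k V)
    (hV : finrank F V = (k + 1) * g.natDegree) :
    finrank F (ker (aeval X g)) = g.natDegree := by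
  obtain ⟨-, hv, hv'⟩ := h
  simp only at hv hv'
  refine le_antisymm ?_ (natDegree_le_finrank_ker hg hg' ?_)
  · have h1 := (aeval X g).finrank_range_add_finrank_ker
    rcases k with - | k
    · rw [zero_add, one_mul] at hV
      omega
    · have h2 := le_finrank_of_order hg hg' (k := k) (X := X) (v := aeval X g v)
        (by rw [← Module.End.mul_apply, ← map_mul, ← pow_succ]; exact hv)
        (by rw [← Module.End.mul_apply, ← map_mul, ← pow_succ]; exact hv')
        (range (aeval X g)) (fun q => ⟨aeval X q v, by
          rw [← Module.End.mul_apply, ← map_mul, mul_comm, map_mul, Module.End.mul_apply]⟩)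
      rw [hV, Nat.succ_mul] at h1
      omega
  · intro h0
    have h1 : aeval X g (aeval X (g ^ k) v) = 0 := by
      rw [← Module.End.mul_apply, ← map_mul, ← pow_succ']; exact hv
    exact hv' (LinearMap.ker_eq_bot'.1 h0 _ h1)

/-- If `g(X)` is nilpotent with kernel of dimension `deg g` on a space of dimension
`(k + 1) deg g` then `g(X) ^ k` has kernel of dimension `k deg g`. -/
lemma finrank_ker_pow_eq {g : F[X]} (hg : g.Monic) (hg' : Irreducible g) {k : ℕ}
    {X : End F V} (hX : IsNilpotent (aeval X g)) (hk : finrank F (ker (aeval X g)) = g.natDegree)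
    (hV : finrank F V = (k + 1) * g.natDegree) :
    aeval X g ^ (k + 1) = 0 ∧ finrank F (ker (aeval X g ^ k)) = k * g.natDegree := by
  have hd := hg'.natDegree_pos
  have htop : (⊤ : Submodule F V) ≠ ⊥ := by
    intro h0
    have h1 : finrank F (⊤ : Submodule F V) = 0 := by rw [h0, finrank_bot]
    rw [finrank_top, hV] at h1
    have : 0 < (k + 1) * g.natDegree := by positivity
    omega
  obtain ⟨s, hs⟩ := hX
  obtain ⟨j, hj, v, -, hv⟩ := exists_order_of_mem (g := g) (X := X) htop (s := s)
    (fun v _ => by rw [map_pow, hs]; rfl)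
  have h1 := le_finrank_of_order hg hg' (hj v trivial) hv ⊤ (fun _ => trivial)
  rw [finrank_top, hV] at h1
  have h2 : j ≤ k := by
    have := Nat.le_of_mul_le_mul_right h1 hd
    omega
  have h3 : aeval X g ^ (k + 1) = 0 := by
    refine LinearMap.ext fun v => ?_
    rw [show k + 1 = (k - j) + (j + 1) by omega, pow_add, Module.End.mul_apply, ← map_pow _ _ (j + 1),
      hj v trivial]
    exact map_zero _
  refine ⟨h3, le_antisymm (hk ▸ finrank_ker_pow_le _ _) ?_⟩
  have h4 := finrank_ker_comp_le (aeval X g ^ k) (aeval X g)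
  rw [← pow_succ, h3, LinearMap.ker_zero, finrank_top, hV, Nat.succ_mul] at h4
  omega

/-- The number of cyclic endomorphisms with characteristic polynomial `g ^ (k + 1)`. -/
lemma card_primaryCyclic [Finite F] {g : F[X]} (hg : g.Monic) (hg' : Irreducible g) {k n : ℕ}
    (hn : n = (k + 1) * g.natDegree) :
    Nat.card {Y : End F (Fin n → F) //
      IsNilpotent (aeval Y g) ∧ finrank F (ker (aeval Y g)) = g.natDegree} *
      (Nat.card F ^ n - Nat.card F ^ (k * g.natDegree)) = glCard F n := by
  have hV : Nat.card (Fin n → F) = Nat.card F ^ n := by rw [Nat.card_fun, Nat.card_fin]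
  have hfin := finite_linearMap (F := F) (Fin n → F) (Fin n → F)
  -- With no complementary block (b = 0), the pair count is the order of the linear group.
  have hP : Nat.card (primaryPairs g k (Fin n → F)) = glCard F n := by
    have h := card_primaryPairs hg hg' (b := 0) (k := k) (n := n) (by omega)
    have : Unique {Y : End F (Fin 0 → F) // IsNilpotent (aeval Y g)} :=
      { default := ⟨0, 1, Subsingleton.elim _ _⟩
        uniq := fun _ => Subsingleton.elim _ _ }
    have h0 : glCard F 0 = 1 := by rw [glCard_eq]; simp
    rw [Nat.card_unique, h0] at h
    omega
  rw [← hP]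
  symm
  let f : primaryPairs g k (Fin n → F) → {Y : End F (Fin n → F) //
      IsNilpotent (aeval Y g) ∧ finrank F (ker (aeval Y g)) = g.natDegree} :=
    fun z => ⟨z.1.1, z.2.1, finrank_ker_eq_of_mem_primaryPairs hg hg' z.2 (by simp [hn])⟩
  -- The vectors paired with a given cyclic Y are those outside ker g(Y)^k, a subspace of dimension
  -- k deg g.
  have hc : ∀ Y : {Y : End F (Fin n → F) //
      IsNilpotent (aeval Y g) ∧ finrank F (ker (aeval Y g)) = g.natDegree},
      Nat.card {z // f z = Y} = Nat.card F ^ n - Nat.card F ^ (k * g.natDegree) := by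
    rintro ⟨Y, hY, hY'⟩
    obtain ⟨h1, h2⟩ := finrank_ker_pow_eq hg hg' (k := k) hY hY' (by simp [hn])
    have h3 : Nat.card {z // f z = ⟨Y, hY, hY'⟩} =
        Nat.card ((ker (aeval Y g ^ k) : Set (Fin n → F))ᶜ : Set (Fin n → F)) := by
      refine Nat.card_congr (Equiv.ofBijective (fun z => ⟨z.1.1.2, fun h0 => ?_⟩) ⟨?_, ?_⟩)
      · have h4 := z.1.2.2.2
        rw [show z.1.1.1 = Y from congrArg Subtype.val z.2, map_pow] at h4
        exact h4 h0
      · rintro ⟨⟨⟨X, v⟩, hX⟩, h⟩ ⟨⟨⟨X', v'⟩, hX'⟩, h'⟩ hv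
        obtain rfl : v = v' := congrArg Subtype.val hv
        obtain rfl : X = Y := congrArg Subtype.val h
        obtain rfl : X' = X := congrArg Subtype.val h'
        rfl
      · rintro ⟨v, hv⟩
        refine ⟨⟨⟨(Y, v), hY, ?_, ?_⟩, rfl⟩, rfl⟩
        · rw [map_pow, h1]; rfl
        · rw [map_pow]; exact hv
    rw [h3, Nat.card_coe_set_eq, Set.ncard_compl, hV, ← Nat.card_coe_set_eq, SetLike.coe_sort_coe,
      Module.natCard_eq_pow_finrank (K := F) (V := ker (aeval Y g ^ k)), h2]
  refine Nat.card_eq_mul_of_card_fiber f ?_ _ hc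
  intro Y
  have hpos : 0 < Nat.card {z // f z = Y} := by
    rw [hc]
    refine Nat.sub_pos_of_lt (Nat.pow_lt_pow_right Finite.one_lt_card ?_)
    rw [hn, Nat.succ_mul]
    have := hg'.natDegree_pos
    omega
  obtain ⟨z, hz⟩ := (Nat.card_pos_iff.1 hpos).1
  exact ⟨z, hz⟩

lemma primaryRatio_eq_sub [Finite F] (g : F[X]) (n : ℕ) :
    primaryRatio g n = nilpotentRatio g n - (Nat.card {Y : End F (Fin n → F) //
      IsNilpotent (aeval Y g) ∧ finrank F (ker (aeval Y g)) = g.natDegree} : ℝ) / glCard F n := by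
  have hfin := finite_linearMap (F := F) (Fin n → F) (Fin n → F)
  have h : Nat.card {Y : End F (Fin n → F) // IsNilpotent (aeval Y g)} =
      Nat.card (primaryNoncyclic g (Fin n → F)) + Nat.card {Y : End F (Fin n → F) //
        IsNilpotent (aeval Y g) ∧ finrank F (ker (aeval Y g)) = g.natDegree} := by
    rw [← Nat.card_sum]
    refine Nat.card_congr (Equiv.ofBijective (Sum.elim (fun Y => ⟨Y.1, Y.2.1⟩)
      (fun Y => ⟨Y.1, Y.2.1⟩)) ⟨?_, ?_⟩).symm
    · rintro (⟨Y, hY⟩ | ⟨Y, hY⟩) (⟨Z, hZ⟩ | ⟨Z, hZ⟩) h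
      · obtain rfl : Y = Z := congrArg Subtype.val h
        rfl
      · obtain rfl : Y = Z := congrArg Subtype.val h
        exact absurd hZ.2 hY.2
      · obtain rfl : Y = Z := congrArg Subtype.val h
        exact absurd hY.2 hZ.2
      · obtain rfl : Y = Z := congrArg Subtype.val h
        rfl
    · rintro ⟨Y, hY⟩
      by_cases h : finrank F (ker (aeval Y g)) = g.natDegree
      · exact ⟨Sum.inr ⟨Y, hY, h⟩, rfl⟩
      · exact ⟨Sum.inl ⟨Y, hY, h⟩, rfl⟩
  rw [nilpotentRatio, primaryRatio, h]
  push_cast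
  ring

lemma primaryRatio_nonneg (g : F[X]) (n : ℕ) : 0 ≤ primaryRatio g n := by
  unfold primaryRatio; positivity

lemma primaryRatio_of_not_dvd [Finite F] {g : F[X]} (hg : g.Monic) (hg' : Irreducible g) {n : ℕ}
    (hn : ¬ g.natDegree ∣ n) : primaryRatio g n = 0 := by
  refine le_antisymm ?_ (primaryRatio_nonneg g n)
  rw [primaryRatio_eq_sub, nilpotentRatio_of_not_dvd hg hg' hn, zero_sub, neg_nonpos]
  positivity

/-- On the zero space the kernel has dimension 0, which differs from deg g, so the only endomorphism
counts as noncyclic. This is the constant term 1 of the local factor. -/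
lemma primaryRatio_zero [Finite F] {g : F[X]} (hg' : Irreducible g) : primaryRatio g 0 = 1 := by
  have : IsEmpty {Y : End F (Fin 0 → F) //
      IsNilpotent (aeval Y g) ∧ finrank F (ker (aeval Y g)) = g.natDegree} := by
    constructor
    rintro ⟨Y, -, h⟩
    have h1 := Submodule.finrank_le (ker (aeval Y g))
    have h2 := hg'.natDegree_pos
    rw [finrank_fin_fun] at h1
    omega
  rw [primaryRatio_eq_sub, nilpotentRatio_zero, Nat.card_of_isEmpty]
  simp

/-- Nilpotent count minus cyclic count. With Q = q^(deg g) the cyclic ratio is 1/(Q^m - Q^(m-1)),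
which is Q^(-m)/(1 - 1/Q). -/
lemma primaryRatio_mul_natDegree [Finite F] {g : F[X]} (hg : g.Monic) (hg' : Irreducible g)
    {m : ℕ} (hm : m ≠ 0) : primaryRatio g (m * g.natDegree) =
      (((Nat.card F : ℝ) ^ g.natDegree)⁻¹) ^ m *
        ((euler (((Nat.card F : ℝ) ^ g.natDegree)⁻¹) m)⁻¹ -
          (euler (((Nat.card F : ℝ) ^ g.natDegree)⁻¹) 1)⁻¹) := by
  obtain ⟨k, rfl⟩ := Nat.exists_eq_succ_of_ne_zero hm
  have h := card_primaryCyclic hg hg' (k := k) (n := (k + 1) * g.natDegree) rfl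
  have hle : Nat.card F ^ (k * g.natDegree) ≤ Nat.card F ^ ((k + 1) * g.natDegree) :=
    Nat.pow_le_pow_right Nat.card_pos (Nat.mul_le_mul_right _ (Nat.le_succ k))
  have h' := congrArg (Nat.cast (R := ℝ)) h
  push_cast [Nat.cast_sub hle] at h'
  have h0 : (0 : ℝ) < glCard F ((k + 1) * g.natDegree) := Nat.cast_pos.2 (glCard_pos _)
  rw [primaryRatio_eq_sub, nilpotentRatio_mul_natDegree hg hg', Nat.succ_eq_add_one, mul_sub,
    div_eq_mul_inv, sub_right_inj, div_eq_iff h0.ne', ← h']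
  have hQ1 : 1 < (Nat.card F : ℝ) ^ g.natDegree := one_lt_natCard_pow hg'.natDegree_pos.ne'
  rw [mul_comm (k + 1), mul_comm k, pow_mul, pow_mul]
  set Q : ℝ := (Nat.card F : ℝ) ^ g.natDegree with hQ
  have h1 : Q - 1 ≠ 0 := by linarith
  have h2 : Q ≠ 0 := by linarith
  have h3 : euler Q⁻¹ 1 = (Q - 1) / Q := by
    rw [euler, Finset.prod_range_one, zero_add, pow_one]
    field_simp
  rw [h3, inv_pow]
  field_simp
  ring

end CyclicCount

/-! ### Uncyclic matrices and dimensions of kernels. -/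

section KernelCriterion

open LinearMap Module

variable {F : Type*} [Field F] {n : ℕ}

lemma dvd_minpoly_of_ker_ne_bot {V : Type*} [AddCommGroup V] [Module F V] [FiniteDimensional F V]
    {T : End F V} {g : F[X]} (hg' : Irreducible g) (h : ker (aeval T g) ≠ ⊥) :
    g ∣ minpoly F T := by
  by_contra hnd
  apply h
  have hc : IsCoprime g (minpoly F T) := (hg'.coprime_iff_not_dvd).2 hnd
  exact ker_aeval_eq_bot_of_nilpotent (g := minpoly F T)
    (by rw [minpoly.aeval]; exact IsNilpotent.zero) hc.symm

/-- If g(T) were injective, the cofactor of `g` in the minimal polynomial would already annihilate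
`T`, at smaller degree. -/
lemma ker_ne_bot_of_dvd_minpoly {V : Type*} [AddCommGroup V] [Module F V] [FiniteDimensional F V]
    {T : End F V} {g : F[X]} (hg' : Irreducible g) (h : g ∣ minpoly F T) :
    ker (aeval T g) ≠ ⊥ := by
  intro h0
  obtain ⟨r, hr⟩ := h
  have h1 : aeval T r = 0 := by
    refine LinearMap.ext fun v => LinearMap.ker_eq_bot'.1 h0 _ ?_
    rw [← Module.End.mul_apply, ← map_mul, ← hr, minpoly.aeval]
    rfl
  have h2 : minpoly F T ≠ 0 := minpoly.ne_zero (Algebra.IsIntegral.isIntegral T)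
  have hr0 : r ≠ 0 := by rintro rfl; exact h2 (by rw [hr, mul_zero])
  have h3 := natDegree_le_of_dvd (minpoly.dvd F T h1) hr0
  rw [hr, natDegree_mul hg'.ne_zero hr0] at h3
  have := hg'.natDegree_pos
  omega

/-- Irreducible divisors of the characteristic polynomial divide the minimal polynomial. -/
lemma dvd_minpoly_of_dvd_charpoly {X : Matrix (Fin n) (Fin n) F} {g : F[X]} (hg' : Irreducible g)
    (h : g ∣ X.charpoly) : g ∣ minpoly F X := by
  have := Fact.mk hg'
  -- Over the field F[X]/(g) the adjoined root is an eigenvalue of X. By spectral mapping the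
  -- minimal polynomial sends it into the spectrum of the zero matrix.
  have h1 : (X.map (algebraMap F (AdjoinRoot g))).charpoly.IsRoot (AdjoinRoot.root g) := by
    rw [Matrix.charpoly_map]
    obtain ⟨r, hr⟩ := h
    rw [hr, Polynomial.map_mul, IsRoot, eval_mul]
    have := AdjoinRoot.eval₂_root g
    rw [eval_map, eval_map]
    exact mul_eq_zero_of_left this _
  have h2 := Matrix.mem_spectrum_of_isRoot_charpoly h1
  have h3 := spectrum.subset_polynomial_aeval (X.map (algebraMap F (AdjoinRoot g)))
    ((minpoly F X).map (algebraMap F (AdjoinRoot g))) ⟨_, h2, rfl⟩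
  have h4 : aeval (X.map (algebraMap F (AdjoinRoot g))) (minpoly F X) = 0 := by
    have := Polynomial.aeval_algHom_apply
      (Algebra.ofId F (AdjoinRoot g)).mapMatrix X (minpoly F X)
    rw [minpoly.aeval, map_zero] at this
    exact this
  have : Nontrivial (Matrix (Fin n) (Fin n) (AdjoinRoot g)) := by
    by_contra hn
    have := not_nontrivial_iff_subsingleton.1 hn
    rw [spectrum.of_subsingleton] at h2
    exact h2
  rw [aeval_map_algebraMap, h4, spectrum.zero_eq, Set.mem_singleton_iff] at h3
  rw [← AdjoinRoot.mk_eq_zero, ← AdjoinRoot.aeval_eq, ← eval_map_algebraMap]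
  exact h3

/-- Passing to the transpose, which keeps the characteristic polynomial, makes results on column
vectors available. -/
lemma vecMulLinear_eq_toLin' (X : Matrix (Fin n) (Fin n) F) :
    X.vecMulLinear = Matrix.toLin' X.transpose := by
  refine LinearMap.ext fun v => ?_
  simp [Matrix.mulVec_transpose]

lemma dvd_charpoly_iff_ker_ne_bot {X : Matrix (Fin n) (Fin n) F} {g : F[X]}
    (hg' : Irreducible g) : g ∣ X.charpoly ↔ ker (aeval X.vecMulLinear g) ≠ ⊥ := by
  constructor
  · intro h
    refine ker_ne_bot_of_dvd_minpoly hg' ?_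
    rw [vecMulLinear_eq_toLin', Matrix.minpoly_toLin']
    exact dvd_minpoly_of_dvd_charpoly hg' (by rwa [Matrix.charpoly_transpose])
  · intro h
    have h1 := dvd_minpoly_of_ker_ne_bot hg' h
    rw [vecMulLinear_eq_toLin', Matrix.minpoly_toLin'] at h1
    rw [← Matrix.charpoly_transpose]
    exact h1.trans (Matrix.minpoly_dvd_charpoly _)

lemma ker_le_primaryComponent {X : Matrix (Fin n) (Fin n) F} {g : F[X]} (hg' : Irreducible g)
    (h : g ∣ X.charpoly) : ker (aeval X.vecMulLinear g) ≤ primaryComponent X g := by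
  intro v hv
  have h1 : g ∣ g ^ multiplicity g X.charpoly := by
    refine dvd_pow_self g ?_
    have hfin : FiniteMultiplicity g X.charpoly :=
      FiniteMultiplicity.of_not_isUnit hg'.not_isUnit X.charpoly_monic.ne_zero
    have := (FiniteMultiplicity.pow_dvd_iff_le_multiplicity hfin (k := 1)).1 (by rwa [pow_one])
    omega
  obtain ⟨r, hr⟩ := h1
  rw [primaryComponent, LinearMap.mem_ker, hr, mul_comm, map_mul, Module.End.mul_apply,
    LinearMap.mem_ker.1 hv, map_zero]

/-- `X` is cyclic on the `g`-primary component if and only if the kernel of `g(X)` has dimension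
`deg g`. -/
lemma isFCyclicRel_iff {X : Matrix (Fin n) (Fin n) F} {g : F[X]} (hg : g.Monic)
    (hg' : Irreducible g) (h : g ∣ X.charpoly) :
    IsFCyclicRel X g ↔ finrank F (ker (aeval X.vecMulLinear g)) = g.natDegree := by
  have hker := (dvd_charpoly_iff_ker_ne_bot hg').1 h
  have hle := ker_le_primaryComponent hg' h
  set T := X.vecMulLinear with hT
  have hstable : ∀ v ∈ primaryComponent X g, ∀ q : F[X], aeval T q v ∈ primaryComponent X g := by
    intro v hv q
    rw [primaryComponent, LinearMap.mem_ker] at hv ⊢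
    rw [← Module.End.mul_apply, ← map_mul, mul_comm, map_mul, Module.End.mul_apply, hv, map_zero]
  have hne : primaryComponent X g ≠ ⊥ := fun h0 => hker (le_bot_iff.1 (h0 ▸ hle))
  obtain ⟨k, hk, u, hu, hu'⟩ := exists_order_of_mem (g := g) (X := T) hne
    (s := multiplicity g X.charpoly) (fun v hv => hv)
  constructor
  · rintro ⟨v, hv, hgen⟩
    refine le_antisymm ?_ (natDegree_le_finrank_ker hg hg' hker)
    -- A generator has the full order g^(k+1), since otherwise g^k would kill the whole component.
    -- Then ker g(T) is generated by g^k(T)v, so its dimension is at most deg g.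
    have hv' : aeval T (g ^ k) v ≠ 0 := by
      intro h0
      obtain ⟨p, rfl⟩ := hgen u hu
      rw [← Module.End.mul_apply, ← map_mul, mul_comm, map_mul, Module.End.mul_apply, h0,
        map_zero] at hu'
      exact hu' rfl
    have h1 : aeval T g (aeval T (g ^ k) v) = 0 := by
      rw [← Module.End.mul_apply, ← map_mul, ← pow_succ']; exact hk v hv
    have h2 : ker (aeval T g) ≤ range (orbitMap hg T (aeval T (g ^ k) v)) := by
      intro w hw
      obtain ⟨p, rfl⟩ := hgen w (hle hw)
      have h3 : aeval T (g * p) v = 0 := by rw [map_mul, Module.End.mul_apply]; exact hw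
      have h4 := pow_dvd_of_aeval_apply_eq_zero hg' (hk v hv) hv' h3
      rw [pow_succ', mul_dvd_mul_iff_left hg'.ne_zero] at h4
      obtain ⟨r, rfl⟩ := h4
      refine ⟨AdjoinRoot.mk g r, ?_⟩
      rw [orbitMap_mk hg h1, ← Module.End.mul_apply, ← map_mul, mul_comm]
    have hfd := finiteDimensional_adjoinRoot hg
    calc finrank F (ker (aeval T g)) ≤ _ := Submodule.finrank_mono h2
      _ ≤ finrank F (AdjoinRoot g) := LinearMap.finrank_range_le _
      _ = g.natDegree := finrank_adjoinRoot hg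
  · intro hfin
    refine ⟨u, hu, fun w hw => ?_⟩
    have hfd := finiteDimensional_adjoinRoot (hg.pow (k + 1))
    have h1 : range (orbitMap (hg.pow (k + 1)) T u) ≤ primaryComponent X g := by
      rintro _ ⟨a, rfl⟩
      obtain ⟨p, rfl⟩ := AdjoinRoot.mk_surjective a
      rw [orbitMap_mk _ (hk u hu)]
      exact hstable u hu p
    have h2 : primaryComponent X g ≤ ker (aeval T g ^ (k + 1)) := by
      intro v hv
      rw [LinearMap.mem_ker, ← map_pow]
      exact hk v hv
    -- The orbit of u has dimension (k+1) deg g, while the component lies in ker g(T)^(k+1), of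
    -- dimension at most k + 1 times that of ker g(T).
    have h3 : range (orbitMap (hg.pow (k + 1)) T u) = primaryComponent X g := by
      refine Submodule.eq_of_le_of_finrank_le h1 ?_
      rw [LinearMap.finrank_range_of_inj (orbitMap_injective hg hg' (hk u hu) hu'),
        finrank_adjoinRoot (hg.pow _), natDegree_pow, ← hfin]
      exact (Submodule.finrank_mono h2).trans (finrank_ker_pow_le _ _)
    rw [← h3] at hw
    obtain ⟨a, rfl⟩ := hw
    obtain ⟨p, rfl⟩ := AdjoinRoot.mk_surjective a
    exact ⟨p, (orbitMap_mk _ (hk u hu) p).symm⟩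

/-- Irreducibles that do not divide the characteristic polynomial impose nothing: their kernel has
dimension 0, which is never their degree. -/
lemma isUncyclic_iff {X : Matrix (Fin n) (Fin n) F} :
    IsUncyclic X ↔ X.vecMulLinear ∈ uncyclicIn Set.univ (Fin n → F) := by
  constructor
  · intro H g hg hg'
    refine ⟨fun _ hfin => ?_, fun h => absurd (Set.mem_univ g) h⟩
    have h : g ∣ X.charpoly := by
      rw [dvd_charpoly_iff_ker_ne_bot hg']
      intro h0
      rw [h0, finrank_bot] at hfin
      exact hg'.natDegree_pos.ne hfin
    exact H g hg hg' h ((isFCyclicRel_iff hg hg' h).2 hfin)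
  · intro H g hg hg' h hcyc
    exact (H g hg hg').1 (Set.mem_univ g) ((isFCyclicRel_iff hg hg' h).1 hcyc)

lemma unc_eq_card [Fintype F] : unc n F = Nat.card (uncyclicIn (Set.univ : Set F[X]) (Fin n → F)) := by
  refine Nat.card_congr (Equiv.subtypeEquiv
    (((Matrix.transposeAddEquiv (Fin n) (Fin n) F).toEquiv).trans Matrix.toLin'.toEquiv) fun X => ?_)
  rw [isUncyclic_iff, vecMulLinear_eq_toLin']
  rfl

end KernelCriterion

/-! ### Reduction to finitely many irreducible polynomials. -/

section FiniteSupport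

open LinearMap Module

variable {F : Type*} [Field F] {n : ℕ}

lemma ker_eq_bot_of_finrank_lt {V : Type*} [AddCommGroup V] [Module F V] [FiniteDimensional F V]
    {T : End F V} {g : F[X]} (hg : g.Monic) (hg' : Irreducible g)
    (h : finrank F V < g.natDegree) : ker (aeval T g) = ⊥ := by
  by_contra h0
  have h1 := natDegree_le_finrank_ker hg hg' h0
  have h2 := Submodule.finrank_le (ker (aeval T g))
  omega

/-- Only irreducible polynomials of degree at most `n` matter. -/
lemma uncyclicIn_univ_eq (S : Set F[X])
    (hS : ∀ g : F[X], g.Monic → Irreducible g → g.natDegree ≤ n → g ∈ S) :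
    uncyclicIn (Set.univ : Set F[X]) (Fin n → F) = uncyclicIn S (Fin n → F) := by
  have hbig : ∀ (T : End F (Fin n → F)) (g : F[X]), g.Monic → Irreducible g → g ∉ S →
      finrank F (ker (aeval T g)) = 0 := by
    intro T g hg hg' h
    rw [ker_eq_bot_of_finrank_lt hg hg', finrank_bot]
    rw [finrank_fin_fun]
    by_contra hlt
    exact h (hS g hg hg' (not_lt.1 hlt))
  refine Set.ext fun T => ⟨fun H g hg hg' => ⟨fun _ => (H g hg hg').1 trivial,
    hbig T g hg hg'⟩, fun H g hg hg' => ⟨fun _ => ?_, fun h => absurd trivial h⟩⟩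
  by_cases h : g ∈ S
  · exact (H g hg hg').1 h
  · rw [hbig T g hg hg' h]
    exact hg'.natDegree_pos.ne

lemma uncyclicIn_mono {S S' : Set F[X]} (h : S ⊆ S') (V : Type*) [AddCommGroup V] [Module F V] :
    uncyclicIn S V ⊆ uncyclicIn S' V := by
  intro T H g hg hg'
  refine ⟨fun _ hfin => ?_, fun hS' => (H g hg hg').2 fun hS => hS' (h hS)⟩
  by_cases hS : g ∈ S
  · exact (H g hg hg').1 hS hfin
  · rw [(H g hg hg').2 hS] at hfin
    exact hg'.natDegree_pos.ne hfin

lemma uncyclicRatio_mono [Finite F] {S S' : Set F[X]} (h : S ⊆ S') (n : ℕ) :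
    uncyclicRatio S n ≤ uncyclicRatio S' n := by
  have hfin := finite_linearMap (F := F) (Fin n → F) (Fin n → F)
  refine div_le_div_of_nonneg_right (Nat.cast_le.2 ?_) (Nat.cast_nonneg _)
  exact Nat.card_mono (Set.toFinite _) (uncyclicIn_mono h _)

lemma uncyclicRatio_nonneg (S : Set F[X]) (n : ℕ) : 0 ≤ uncyclicRatio S n := by
  unfold uncyclicRatio; positivity

lemma uncyclicRatio_empty_zero [Finite F] : uncyclicRatio (∅ : Set F[X]) 0 = 1 := by
  have : Unique (uncyclicIn (∅ : Set F[X]) (Fin 0 → F)) :=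
    { default := ⟨0, fun g hg hg' => ⟨fun h => absurd h (Set.notMem_empty g), fun _ => by
        rw [ker_eq_bot_of_finrank_lt hg hg' (by simpa using hg'.natDegree_pos), finrank_bot]⟩⟩
      uniq := fun _ => Subsingleton.elim _ _ }
  rw [uncyclicRatio, Nat.card_unique, glCard_eq]
  simp

/-- On a nonzero space the minimal polynomial is not a unit, so some irreducible factor has a
nonzero kernel. -/
lemma uncyclicRatio_empty [Finite F] (hn : n ≠ 0) : uncyclicRatio (∅ : Set F[X]) n = 0 := by
  have : IsEmpty (uncyclicIn (∅ : Set F[X]) (Fin n → F)) := by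
    constructor
    rintro ⟨T, hT⟩
    have hne : ¬ IsUnit (minpoly F T) := by
      have : Nonempty (Fin n) := ⟨⟨0, Nat.pos_of_ne_zero hn⟩⟩
      exact minpoly.not_isUnit F T
    obtain ⟨g, hg, hg', hdvd⟩ := Polynomial.exists_monic_irreducible_factor _ hne
    exact ker_ne_bot_of_dvd_minpoly hg' hdvd
      (Submodule.finrank_eq_zero.1 ((hT g hg hg').2 (Set.notMem_empty g)))
  rw [uncyclicRatio, Nat.card_of_isEmpty]
  simp

end FiniteSupport

/-! ### Counting monic irreducible polynomials. -/

section IrreducibleCount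

variable {F : Type*} [Field F] [Finite F]

lemma finite_natDegree_le (n : ℕ) : {g : F[X] | g.natDegree ≤ n}.Finite := by
  have : Finite (degreeLT F (n + 1)) :=
    Finite.of_equiv _ (degreeLTEquiv F (n + 1)).toEquiv.symm
  refine Set.Finite.subset (Set.toFinite (degreeLT F (n + 1) : Set F[X])) fun g hg => ?_
  have hg' : g.natDegree ≤ n := hg
  exact mem_degreeLT.2 (lt_of_le_of_lt degree_le_natDegree (by exact_mod_cast Nat.lt_succ_of_le hg'))

variable (F) in
/-- The monic irreducible polynomials of degree at most `n`. -/
noncomputable def irreducibles (n : ℕ) : Finset F[X] :=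
  ((finite_natDegree_le n).subset (t := {g : F[X] | g.Monic ∧ Irreducible g ∧ g.natDegree ≤ n})
    fun _ h => h.2.2).toFinset

lemma mem_irreducibles {n : ℕ} {g : F[X]} :
    g ∈ irreducibles F n ↔ g.Monic ∧ Irreducible g ∧ g.natDegree ≤ n := by
  rw [irreducibles, Set.Finite.mem_toFinset]; rfl

variable (F) in
open Classical in
/-- The number of monic irreducible polynomials of degree `d`. -/
noncomputable def irreducibleCount (d : ℕ) : ℕ :=
  ((irreducibles F d).filter fun g => g.natDegree = d).card

open Classical in
lemma filter_irreducibles {n d : ℕ} (hd : d ≤ n) :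
    (irreducibles F n).filter (fun g => g.natDegree = d) =
      (irreducibles F d).filter fun g => g.natDegree = d := by
  ext g
  simp only [Finset.mem_filter, mem_irreducibles]
  constructor
  · rintro ⟨⟨h1, h2, h3⟩, h4⟩; exact ⟨⟨h1, h2, h4.le⟩, h4⟩
  · rintro ⟨⟨h1, h2, h3⟩, h4⟩; exact ⟨⟨h1, h2, by omega⟩, h4⟩

lemma sum_irreducibles (n : ℕ) (f : ℕ → ℝ) :
    ∑ g ∈ irreducibles F n, f g.natDegree =
      ∑ d ∈ Finset.Icc 1 n, (irreducibleCount F d : ℝ) * f d := by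
  classical
  rw [← Finset.sum_fiberwise_of_maps_to (t := Finset.Icc 1 n) (g := natDegree)]
  · refine Finset.sum_congr rfl fun d hd => ?_
    rw [filter_irreducibles (Finset.mem_Icc.1 hd).2, irreducibleCount, ← nsmul_eq_mul,
      ← Finset.sum_const]
    exact Finset.sum_congr rfl fun g hg => by rw [(Finset.mem_filter.1 hg).2]
  · intro g hg
    obtain ⟨-, h2, h3⟩ := mem_irreducibles.1 hg
    exact Finset.mem_Icc.2 ⟨h2.natDegree_pos, h3⟩

variable (F) in
lemma irreducibleCount_one : irreducibleCount F 1 = Nat.card F := by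
  classical
  have := Fintype.ofFinite F
  have h : (irreducibles F 1).filter (fun g => g.natDegree = 1) =
      Finset.univ.image fun a : F => X - C a := by
    ext g
    simp only [Finset.mem_filter, mem_irreducibles, Finset.mem_image, Finset.mem_univ, true_and]
    constructor
    · rintro ⟨⟨h1, -, -⟩, h4⟩
      refine ⟨-g.coeff 0, ?_⟩
      rw [C_neg, sub_neg_eq_add]
      exact (h1.eq_X_add_C h4).symm
    · rintro ⟨a, rfl⟩
      exact ⟨⟨monic_X_sub_C a, irreducible_X_sub_C a, (natDegree_X_sub_C a).le⟩,
        natDegree_X_sub_C a⟩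
  rw [irreducibleCount, h, Finset.card_image_of_injective _ fun a b hab => by simpa using hab,
    Finset.card_univ, Nat.card_eq_fintype_card]

-- The irreducibles of degree d and of degree 1 are pairwise coprime divisors of X^(q^d) - X;
-- compare degrees.
variable (F) in
lemma irreducibleCount_le {d : ℕ} (hd : 2 ≤ d) :
    d * irreducibleCount F d + Nat.card F ≤ Nat.card F ^ d := by
  classical
  have := Fintype.ofFinite F
  let A := (irreducibles F d).filter fun g => g.natDegree = d
  let B := (irreducibles F 1).filter fun g => g.natDegree = 1
  have hAB : Disjoint A B := by
    rw [Finset.disjoint_left]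
    intro g hA hB
    have h1 := (Finset.mem_filter.1 hA).2
    have h2 := (Finset.mem_filter.1 hB).2
    omega
  have hprop : ∀ g ∈ A ∪ B, g.Monic ∧ Irreducible g ∧ g.natDegree ∣ d := by
    intro g hg
    rcases Finset.mem_union.1 hg with h | h
    · obtain ⟨h1, h2⟩ := Finset.mem_filter.1 h
      exact ⟨(mem_irreducibles.1 h1).1, (mem_irreducibles.1 h1).2.1, h2 ▸ dvd_rfl⟩
    · obtain ⟨h1, h2⟩ := Finset.mem_filter.1 h
      exact ⟨(mem_irreducibles.1 h1).1, (mem_irreducibles.1 h1).2.1, h2 ▸ one_dvd _⟩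
  have hdvd : ∏ g ∈ A ∪ B, g ∣ X ^ Nat.card F ^ d - X := by
    refine Finset.prod_dvd_of_coprime ?_ ?_
    · intro g hg h hh hne
      exact isCoprime_of_monic_irreducible (hprop g hg).1 (hprop g hg).2.1 (hprop h hh).1
        (hprop h hh).2.1 hne.symm
    · intro g hg
      exact ((hprop g hg).2.1.natDegree_dvd_iff_dvd_X_pow_card_pow_sub_X).1 (hprop g hg).2.2
  have h1 := natDegree_le_of_dvd hdvd
    (FiniteField.X_pow_card_pow_sub_X_ne_zero F (by omega) Finite.one_lt_card)
  rw [FiniteField.X_pow_card_pow_sub_X_natDegree_eq F (by omega) Finite.one_lt_card,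
    natDegree_prod_of_monic _ _ fun g hg => (hprop g hg).1, Finset.sum_union hAB,
    Finset.sum_const_nat (s := A) (m := d) fun g hg => (Finset.mem_filter.1 hg).2,
    Finset.sum_const_nat (s := B) (m := 1) fun g hg => (Finset.mem_filter.1 hg).2, mul_one] at h1
  have hB : B.card = Nat.card F := irreducibleCount_one F
  rw [hB, mul_comm] at h1
  exact h1

end IrreducibleCount

/-! ### The recursive upper inequality. -/

section Recursion

variable {F : Type*} [Field F] [Finite F]

lemma uncyclicRatio_univ_eq (n : ℕ) :
    uncyclicRatio (Set.univ : Set F[X]) n = uncyclicRatio (irreducibles F n : Set F[X]) n := by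
  rw [uncyclicRatio, uncyclicRatio, uncyclicIn_univ_eq (irreducibles F n : Set F[X])
    fun g h1 h2 h3 => mem_irreducibles.2 ⟨h1, h2, h3⟩]

lemma uncyclicRatio_insert_eq_add {g : F[X]} {S : Set F[X]} (hg : g.Monic) (hg' : Irreducible g)
    (hgS : g ∉ S) (n : ℕ) : uncyclicRatio (insert g S) n = uncyclicRatio S n +
      ∑ k ∈ Finset.range n, primaryRatio g (k + 1) * uncyclicRatio S (n - (k + 1)) := by
  rw [uncyclicRatio_insert hg hg' hgS, Finset.sum_range_succ', primaryRatio_zero hg', one_mul,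
    Nat.sub_zero, add_comm]

/-- Remove the polynomials one at a time, and at each removal bound the ratio of the remaining set
by that of all polynomials. -/
lemma uncyclicRatio_le_sum (S : Finset F[X]) (hS : ∀ g ∈ S, g.Monic ∧ Irreducible g) {n : ℕ}
    (hn : n ≠ 0) : uncyclicRatio (S : Set F[X]) n ≤
      ∑ g ∈ S, ∑ k ∈ Finset.range n,
        primaryRatio g (k + 1) * uncyclicRatio (Set.univ : Set F[X]) (n - (k + 1)) := by
  classical
  induction S using Finset.induction_on with
  | empty => rw [Finset.coe_empty, uncyclicRatio_empty hn, Finset.sum_empty]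
  | insert g S hgS ih =>
    obtain ⟨hg, hg'⟩ := hS g (Finset.mem_insert_self _ _)
    rw [Finset.coe_insert, uncyclicRatio_insert_eq_add hg hg' (by simpa using hgS),
      Finset.sum_insert hgS, add_comm]
    refine add_le_add (Finset.sum_le_sum fun k _ => ?_)
      (ih fun h hh => hS h (Finset.mem_insert_of_mem hh))
    exact mul_le_mul_of_nonneg_left (uncyclicRatio_mono (Set.subset_univ _) _)
      (primaryRatio_nonneg _ _)

lemma uncyclicRatio_zero : uncyclicRatio (Set.univ : Set F[X]) 0 = 1 := by
  have : irreducibles F 0 = ∅ := by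
    ext g
    rw [mem_irreducibles]
    simp only [Finset.notMem_empty, iff_false]
    rintro ⟨-, h2, h3⟩
    have := h2.natDegree_pos
    omega
  rw [uncyclicRatio_univ_eq, this, Finset.coe_empty, uncyclicRatio_empty_zero]

/-- `1 / euler x m - 1 / euler x 1`. -/
noncomputable def eulerGap (x : ℝ) (m : ℕ) : ℝ := (euler x m)⁻¹ - (euler x 1)⁻¹

variable (F) in
/-- `q ^ n` times the proportion of uncyclic endomorphisms. -/
noncomputable def scaledRatio (n : ℕ) : ℝ :=
  (Nat.card F : ℝ) ^ n * uncyclicRatio (Set.univ : Set F[X]) n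

lemma sum_range_dvd (n d : ℕ) (hd : 0 < d) (f : ℕ → ℝ) (hf : ∀ j, ¬ d ∣ j → f j = 0) (h1 : f d = 0) :
    ∑ k ∈ Finset.range n, f (k + 1) = ∑ m ∈ Finset.Icc 2 (n / d), f (m * d) := by
  have hinj : ∀ a ∈ Finset.Icc 2 (n / d), ∀ b ∈ Finset.Icc 2 (n / d),
      a * d - 1 = b * d - 1 → a = b := by
    intro a ha b hb hab
    have h1 : 0 < a * d := Nat.mul_pos (by have := (Finset.mem_Icc.1 ha).1; omega) hd
    have h2 : 0 < b * d := Nat.mul_pos (by have := (Finset.mem_Icc.1 hb).1; omega) hd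
    exact Nat.eq_of_mul_eq_mul_right hd (by omega)
  have hsub : (Finset.Icc 2 (n / d)).image (fun m => m * d - 1) ⊆ Finset.range n := by
    intro k hk
    obtain ⟨m, hm, rfl⟩ := Finset.mem_image.1 hk
    obtain ⟨hm1, hm2⟩ := Finset.mem_Icc.1 hm
    have h1 := (Nat.le_div_iff_mul_le hd).1 hm2
    have h2 : 0 < m * d := Nat.mul_pos (by omega) hd
    exact Finset.mem_range.2 (by omega)
  rw [← Finset.sum_subset hsub, Finset.sum_image hinj]
  · refine Finset.sum_congr rfl fun m hm => ?_
    have h2 : 0 < m * d := Nat.mul_pos (by have := (Finset.mem_Icc.1 hm).1; omega) hd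
    rw [Nat.sub_add_cancel h2]
  · intro k hk hk'
    by_cases hdvd : d ∣ k + 1
    · obtain ⟨m, hm⟩ := hdvd
      rcases Nat.lt_or_ge m 2 with h | h
      · interval_cases m
        · omega
        · rw [hm, mul_one, h1]
      · refine absurd (Finset.mem_image.2 ⟨m, Finset.mem_Icc.2 ⟨h, ?_⟩, ?_⟩) hk'
        · rw [Nat.le_div_iff_mul_le hd, mul_comm, ← hm]
          have := Finset.mem_range.1 hk
          omega
        · rw [mul_comm, ← hm, Nat.add_sub_cancel]
    · exact hf _ hdvd

/-- The factor q^n absorbs the power q^(-m deg g) in each local coefficient and leaves the gap. The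
sum starts at m = 2 because the gap vanishes at m = 1. -/
lemma scaledRatio_le {n : ℕ} (hn : n ≠ 0) :
    scaledRatio F n ≤ ∑ g ∈ irreducibles F n, ∑ m ∈ Finset.Icc 2 (n / g.natDegree),
      eulerGap (((Nat.card F : ℝ) ^ g.natDegree)⁻¹) m * scaledRatio F (n - m * g.natDegree) := by
  have hq : (0 : ℝ) < Nat.card F := Nat.cast_pos.2 Nat.card_pos
  have h := uncyclicRatio_le_sum (irreducibles F n)
    (fun g hg => ⟨(mem_irreducibles.1 hg).1, (mem_irreducibles.1 hg).2.1⟩) hn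
  rw [← uncyclicRatio_univ_eq] at h
  refine (mul_le_mul_of_nonneg_left h (pow_nonneg hq.le n)).trans (le_of_eq ?_)
  rw [Finset.mul_sum]
  refine Finset.sum_congr rfl fun g hg => ?_
  obtain ⟨hg1, hg2, -⟩ := mem_irreducibles.1 hg
  have hd := hg2.natDegree_pos
  rw [sum_range_dvd n g.natDegree hd
    (fun j => primaryRatio g j * uncyclicRatio (Set.univ : Set F[X]) (n - j)), Finset.mul_sum]
  · refine Finset.sum_congr rfl fun m hm => ?_
    obtain ⟨hm1, hm2⟩ := Finset.mem_Icc.1 hm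
    have h1 := (Nat.le_div_iff_mul_le hd).1 hm2
    rw [primaryRatio_mul_natDegree hg1 hg2 (by omega), eulerGap, scaledRatio]
    have h2 : (Nat.card F : ℝ) ^ n =
        (Nat.card F : ℝ) ^ (n - m * g.natDegree) * ((Nat.card F : ℝ) ^ g.natDegree) ^ m := by
      rw [← pow_mul, ← pow_add]
      congr 1
      rw [mul_comm m] at h1 ⊢
      omega
    rw [h2, inv_pow]
    field_simp
  · intro j hj
    rw [primaryRatio_of_not_dvd hg1 hg2 hj, zero_mul]
  · have := primaryRatio_mul_natDegree hg1 hg2 (m := 1) one_ne_zero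
    rw [sub_self, mul_zero, one_mul] at this
    rw [this, zero_mul]

lemma scaledRatio_nonneg (F : Type*) [Field F] (n : ℕ) : 0 ≤ scaledRatio F n :=
  mul_nonneg (by positivity) (uncyclicRatio_nonneg _ _)

lemma scaledRatio_zero : scaledRatio F 0 = 1 := by
  rw [scaledRatio, uncyclicRatio_zero, pow_zero, one_mul]

lemma glCard_eq_euler (n : ℕ) : (glCard F n : ℝ) =
    (Nat.card F : ℝ) ^ (n ^ 2) * euler (Nat.card F : ℝ)⁻¹ n := by
  have hq : (0 : ℝ) < Nat.card F := Nat.cast_pos.2 Nat.card_pos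
  rw [glCard_eq, Fin.prod_univ_eq_prod_range (fun i => Nat.card F ^ n - Nat.card F ^ i),
    ← Finset.prod_range_reflect, Nat.cast_prod, euler, sq, pow_mul,
    show ((Nat.card F : ℝ) ^ n) ^ n = ∏ _i ∈ Finset.range n, (Nat.card F : ℝ) ^ n by simp,
    ← Finset.prod_mul_distrib]
  refine Finset.prod_congr rfl fun i hi => ?_
  have hi' := Finset.mem_range.1 hi
  rw [Nat.cast_sub (Nat.pow_le_pow_right Nat.card_pos (by omega))]
  push_cast
  have h2 : (Nat.card F : ℝ) ^ n = (Nat.card F : ℝ) ^ (n - 1 - i) * (Nat.card F : ℝ) ^ (i + 1) := by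
    rw [← pow_add]
    congr 1
    omega
  rw [mul_sub, mul_one, inv_pow, sub_right_inj, h2]
  field_simp

lemma unc_div_eq {F : Type*} [Field F] [Fintype F] (n : ℕ) :
    (unc n F : ℝ) / (Nat.card F : ℝ) ^ (n ^ 2) =
      euler (Nat.card F : ℝ)⁻¹ n * uncyclicRatio (Set.univ : Set F[X]) n := by
  have hq : (0 : ℝ) < Nat.card F := Nat.cast_pos.2 Nat.card_pos
  have h0 : (0 : ℝ) < glCard F n := Nat.cast_pos.2 (glCard_pos n)
  rw [unc_eq_card, uncyclicRatio]
  rw [glCard_eq_euler] at h0 ⊢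
  have h1 : euler (Nat.card F : ℝ)⁻¹ n ≠ 0 := by
    intro h; rw [h, mul_zero] at h0; exact lt_irrefl _ h0
  rw [mul_div_assoc', div_eq_div_iff (by positivity) h0.ne']
  ring

end Recursion

/-! ### Estimates for the Euler products. -/

section EulerProduct

/-- The product `(1 - x ^ 2) (1 - x ^ 3) ⋯ (1 - x ^ (k + 1))`. -/
noncomputable def eulerTail (x : ℝ) (k : ℕ) : ℝ := ∏ i ∈ Finset.range k, (1 - x ^ (i + 2))

lemma eulerTail_succ (x : ℝ) (k : ℕ) : eulerTail x (k + 1) = eulerTail x k * (1 - x ^ (k + 2)) :=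
  Finset.prod_range_succ _ _

lemma euler_succ_eq (x : ℝ) (k : ℕ) : euler x (k + 1) = (1 - x) * eulerTail x k := by
  rw [euler, Finset.prod_range_succ', eulerTail, zero_add, pow_one, mul_comm]

lemma eulerGap_succ (x : ℝ) (k : ℕ) :
    eulerGap x (k + 1) = (1 - x)⁻¹ * ((eulerTail x k)⁻¹ - 1) := by
  have h : euler x 1 = 1 - x := by simp [euler]
  rw [eulerGap, euler_succ_eq, h, mul_inv]
  ring

variable {x : ℝ}

lemma eulerTail_pos (h0 : 0 < x) (h1 : x < 1) (k : ℕ) : 0 < eulerTail x k :=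
  Finset.prod_pos fun i _ => sub_pos.2 (pow_lt_one₀ h0.le h1 (by omega))

lemma eulerTail_antitone (h0 : 0 < x) (h1 : x < 1) : Antitone (eulerTail x) := by
  refine antitone_nat_of_succ_le fun k => ?_
  rw [eulerTail_succ]
  have := eulerTail_pos h0 h1 k
  have : 0 < x ^ (k + 2) := by positivity
  nlinarith

lemma eulerTail_le_one (h0 : 0 < x) (h1 : x < 1) (k : ℕ) : eulerTail x k ≤ 1 := by
  have := eulerTail_antitone h0 h1 (Nat.zero_le k)
  simpa [eulerTail] using this

lemma eulerTail_le_one_sub_sq (h0 : 0 < x) (h1 : x < 1) {k : ℕ} (hk : 1 ≤ k) :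
    eulerTail x k ≤ 1 - x ^ 2 := by
  have := eulerTail_antitone h0 h1 hk
  simpa [eulerTail] using this

/-- Induction on j. The base case asks that 1 - x^2 be at most (1 - x^(k+2))(1 - x^(k+3)); the worst
case k = 1 reduces to x + x^3 ≤ 1. -/
lemma eulerTail_mul_le (h0 : 0 < x) (h1 : x ≤ 1 / 2) {k j : ℕ} (hk : 1 ≤ k) (hj : 1 ≤ j) :
    eulerTail x k * eulerTail x j ≤ eulerTail x (k + j + 1) := by
  have h1' : x < 1 := by linarith
  induction j, hj using Nat.le_induction with
  | base =>
    rw [eulerTail_succ x (k + 1), eulerTail_succ x k, mul_assoc]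
    refine mul_le_mul_of_nonneg_left ?_ (eulerTail_pos h0 h1' k).le
    have e1 : eulerTail x 1 = 1 - x ^ 2 := by simp [eulerTail]
    have e2 : x ^ (k + 2) ≤ x ^ 3 := pow_le_pow_of_le_one h0.le h1'.le (by omega)
    have e3 : x ^ (k + 1 + 2) ≤ x ^ 4 := pow_le_pow_of_le_one h0.le h1'.le (by omega)
    have e4 : x ^ 3 ≤ 1 := pow_le_one₀ h0.le h1'.le
    have e5 : x ^ 4 ≤ 1 := pow_le_one₀ h0.le h1'.le
    rw [e1]
    have e6 : (1 - x ^ 3) * (1 - x ^ 4) ≤ (1 - x ^ (k + 2)) * (1 - x ^ (k + 1 + 2)) := by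
      apply mul_le_mul <;> linarith
    have e7 : 0 ≤ (1 - x ^ 2) * (x ^ 2 * (1 - x - x ^ 3)) := by
      have : 0 ≤ 1 - x ^ 2 := by nlinarith
      have : 0 ≤ 1 - x - x ^ 3 := by nlinarith [mul_pos h0 h0, mul_pos (mul_pos h0 h0) h0]
      positivity
    nlinarith
  | succ j hj ih =>
    rw [eulerTail_succ x j, ← mul_assoc, show k + (j + 1) + 1 = (k + j + 1) + 1 by ring,
      eulerTail_succ x (k + j + 1)]
    have e1 : x ^ (k + j + 1 + 2) ≤ x ^ (j + 2) := pow_le_pow_of_le_one h0.le h1'.le (by omega)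
    have e2 : x ^ (j + 2) ≤ 1 := pow_le_one₀ h0.le h1'.le
    exact mul_le_mul ih (by linarith) (by linarith) (eulerTail_pos h0 h1' _).le

/-- A lower bound for all partial products from one of them. -/
lemma le_eulerTail (h0 : 0 < x) (h1 : x ≤ 1 / 2) (K k : ℕ) :
    eulerTail x K * (1 - x ^ (K + 2) / (1 - x)) ≤ eulerTail x k := by
  have h1' : x < 1 := by linarith
  have h2 : 0 < 1 - x := by linarith
  have hK := eulerTail_pos h0 h1' K
  -- The product of factors 1 - a_i is at least 1 minus the sum of the a_i, here a finite geometric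
  -- sum.
  have key : ∀ j, eulerTail x K * (1 - (x ^ (K + 2) - x ^ (K + 2 + j)) / (1 - x)) ≤
      eulerTail x (K + j) := by
    intro j
    induction j with
    | zero => simp
    | succ j ih =>
      rw [show K + (j + 1) = (K + j) + 1 from rfl, eulerTail_succ]
      have e0 : 0 < x ^ (K + j + 2) := by positivity
      have e1 : x ^ (K + j + 2) ≤ 1 := pow_le_one₀ h0.le h1'.le
      have e2 := mul_le_mul_of_nonneg_right ih (sub_nonneg.2 e1)
      refine le_trans ?_ e2
      rw [mul_assoc]
      refine mul_le_mul_of_nonneg_left ?_ hK.le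
      have e3 : (x ^ (K + 2) - x ^ (K + 2 + (j + 1))) / (1 - x) =
          (x ^ (K + 2) - x ^ (K + 2 + j)) / (1 - x) + x ^ (K + j + 2) := by
        field_simp
        ring
      have e4 : 0 ≤ (x ^ (K + 2) - x ^ (K + 2 + j)) / (1 - x) :=
        div_nonneg (sub_nonneg.2 (pow_le_pow_of_le_one h0.le h1'.le (by omega))) h2.le
      rw [e3]
      nlinarith
  have h3 := key k
  refine le_trans ?_ (h3.trans (eulerTail_antitone h0 h1' (by omega)))
  refine mul_le_mul_of_nonneg_left ?_ hK.le
  have : (x ^ (K + 2) - x ^ (K + 2 + k)) / (1 - x) ≤ x ^ (K + 2) / (1 - x) := by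
    refine div_le_div_of_nonneg_right ?_ h2.le
    have : 0 < x ^ (K + 2 + k) := by positivity
    linarith
  linarith

lemma eulerGap_nonneg (h0 : 0 < x) (h1 : x < 1) (m : ℕ) (hm : m ≠ 0) : 0 ≤ eulerGap x m := by
  obtain ⟨k, rfl⟩ := Nat.exists_eq_succ_of_ne_zero hm
  rw [Nat.succ_eq_add_one, eulerGap_succ]
  have h2 := eulerTail_pos h0 h1 k
  have h3 : 1 ≤ (eulerTail x k)⁻¹ := (one_le_inv₀ h2).2 (eulerTail_le_one h0 h1 k)
  have h4 : 0 < 1 - x := by linarith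
  have : 0 ≤ (eulerTail x k)⁻¹ - 1 := by linarith
  positivity

lemma eulerGap_le_of_le_eulerTail (h1 : x < 1) {L B : ℝ} (hL : ∀ k, L ≤ eulerTail x k)
    (hL0 : 0 < L) (hB : 1 ≤ L * (1 + (1 - x) * B)) {m : ℕ} (hm : m ≠ 0) : eulerGap x m ≤ B := by
  obtain ⟨k, rfl⟩ := Nat.exists_eq_succ_of_ne_zero hm
  rw [Nat.succ_eq_add_one, eulerGap_succ, inv_mul_le_iff₀ (by linarith), sub_le_iff_le_add,
    add_comm]
  refine (inv_anti₀ hL0 (hL k)).trans ?_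
  rwa [inv_le_iff_one_le_mul₀ hL0, mul_comm]

/-- The tail is bounded below from its first two factors. Clearing denominators leaves x^4 times a
polynomial whose low-order part 2.6 - 11.2x + 2x^2 + 8.6x^3 is still about 0.06 at x = 1/4; this is
what the constant 6.6 is tuned for. -/
lemma eulerGap_le (h0 : 0 < x) (h1 : x ≤ 1 / 4) {m : ℕ} (hm : m ≠ 0) :
    eulerGap x m ≤ x ^ 2 * (1 + 2 * x + 6.6 * x ^ 2) := by
  have e : eulerTail x 2 = (1 - x ^ 2) * (1 - x ^ 3) := by
    simp [eulerTail, Finset.prod_range_succ]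
  have h2 : 0 < 1 - x := by linarith
  have h3 : 0 < 1 - x ^ 4 / (1 - x) := by
    rw [sub_pos, div_lt_one h2]
    have : x ^ 4 ≤ (1 / 4) ^ 4 := pow_le_pow_left₀ h0.le h1 4
    norm_num at this
    linarith
  refine eulerGap_le_of_le_eulerTail (by linarith)
    (L := eulerTail x 2 * (1 - x ^ 4 / (1 - x))) (fun k => le_eulerTail h0 (by linarith) 2 k)
    (mul_pos (eulerTail_pos h0 (by linarith) 2) h3) ?_ hm
  rw [e]
  have h4 : (1 - x ^ 2) * (1 - x ^ 3) * (1 - x ^ 4 / (1 - x)) *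
      (1 + (1 - x) * (x ^ 2 * (1 + 2 * x + 6.6 * x ^ 2))) =
      (1 - x ^ 2) * (1 - x ^ 3) * (1 - x - x ^ 4) *
      (1 + (1 - x) * (x ^ 2 * (1 + 2 * x + 6.6 * x ^ 2))) / (1 - x) := by
    field_simp
  rw [h4, le_div_iff₀ h2, one_mul]
  have h5 : 0 ≤ 2.6 - 11.2 * x + 2 * x ^ 2 + 8.6 * x ^ 3 := by
    nlinarith [sq_nonneg (x - 1 / 4), mul_nonneg (sq_nonneg (x - 1 / 4)) (by linarith : 0 ≤ x + 1 / 2)]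
  have h6 : 0 ≤ x ^ 5 * (4.6 - 5.6 * x) := mul_nonneg (by positivity) (by linarith)
  have h7 : 0 ≤ x ^ 7 * (3.6 - 7.6 * x) := mul_nonneg (by positivity) (by linarith)
  have h8 : 0 ≤ x ^ 4 * (1 - 4.6 * x ^ 5) := by
    refine mul_nonneg (by positivity) ?_
    have : x ^ 5 ≤ (1 / 4) ^ 5 := pow_le_pow_left₀ h0.le h1 5
    norm_num at this
    linarith
  have h9 : 0 ≤ x ^ 10 := by positivity
  have h10 : 0 ≤ x ^ 4 * (2.6 - 11.2 * x + 2 * x ^ 2 + 8.6 * x ^ 3 + x ^ 5 * (4.6 - 5.6 * x) +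
      x ^ 7 * (3.6 - 7.6 * x) + x ^ 4 * (1 - 4.6 * x ^ 5) + 6.6 * x ^ 10) :=
    mul_nonneg (by positivity) (by linarith)
  linear_combination h10

end EulerProduct

/-! ### The lower bound, and the exact value for n = 3. -/

section LowerBound

variable {F : Type*} [Field F] [Finite F]

lemma inv_natCard_pos (F : Type*) [Field F] [Finite F] : (0 : ℝ) < (Nat.card F : ℝ)⁻¹ :=
  inv_pos.2 (Nat.cast_pos.2 Nat.card_pos)

lemma inv_natCard_le_half (F : Type*) [Field F] [Finite F] : (Nat.card F : ℝ)⁻¹ ≤ 1 / 2 := by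
  have : (2 : ℝ) ≤ Nat.card F := by exact_mod_cast Finite.one_lt_card (α := F)
  rw [one_div]
  exact inv_anti₀ (by norm_num) this

/-- The value of `primaryRatio (X - C a) k`, which does not depend on `a`. -/
lemma primaryRatio_X_sub_C (a : F) {k : ℕ} (hk : k ≠ 0) : primaryRatio (X - C a) k =
    (Nat.card F : ℝ)⁻¹ ^ k * eulerGap (Nat.card F : ℝ)⁻¹ k := by
  have h := primaryRatio_mul_natDegree (monic_X_sub_C a) (irreducible_X_sub_C a) hk
  rwa [natDegree_X_sub_C, mul_one, pow_one] at h

/-- Two-eigenvalue lower bound for the number of uncyclic endomorphisms all of whose eigenvalues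
lie in a given finite set. -/
lemma le_uncyclicRatio_linear (b : ℕ → ℝ)
    (hb : ∀ (a : F) (k : ℕ), k ≠ 0 → primaryRatio (X - C a) k = b k) (S : Finset F) :
    uncyclicRatio ((fun a : F => X - C a) '' (S : Set F)) 0 = 1 ∧ ∀ N,
      S.card * b (N + 1) + (S.card * (S.card - 1) / 2) *
        ∑ k ∈ Finset.range N, b (k + 1) * b (N - k) ≤
          uncyclicRatio ((fun a : F => X - C a) '' (S : Set F)) (N + 1) := by
  classical
  have hb0 : ∀ (_ : F) k, k ≠ 0 → 0 ≤ b k := fun a k hk => hb a k hk ▸ primaryRatio_nonneg _ _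
  induction S using Finset.induction_on with
  | empty =>
    rw [Finset.coe_empty, Set.image_empty, uncyclicRatio_empty_zero]
    refine ⟨rfl, fun N => ?_⟩
    rw [uncyclicRatio_empty (Nat.succ_ne_zero N)]
    simp
  | insert a S ha ih =>
    obtain ⟨ih0, ih⟩ := ih
    have hmem : (X - C a : F[X]) ∉ (fun a : F => X - C a) '' (S : Set F) := by
      rintro ⟨c, hc, h⟩
      have : c = a := by simpa using h
      exact ha (this ▸ hc)
    rw [Finset.coe_insert, Set.image_insert_eq, Finset.card_insert_of_notMem ha]
    have hins := uncyclicRatio_insert_eq_add (monic_X_sub_C a) (irreducible_X_sub_C a) hmem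
    refine ⟨by rw [hins, ih0]; simp, fun N => ?_⟩
    rw [hins, Finset.sum_range_succ, Nat.sub_self, ih0, mul_one, hb a _ (Nat.succ_ne_zero N)]
    -- The new eigenvalue is paired with each old one; only the one-eigenvalue part of the induction
    -- hypothesis is kept. The pair count grows by s, from s(s-1)/2 to (s+1)s/2.
    have h1 : ∑ k ∈ Finset.range N, (S.card : ℝ) * (b (k + 1) * b (N - k)) ≤
        ∑ k ∈ Finset.range N, primaryRatio (X - C a) (k + 1) *
          uncyclicRatio ((fun a : F => X - C a) '' (S : Set F)) (N + 1 - (k + 1)) := by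
      refine Finset.sum_le_sum fun k hk => ?_
      rw [hb a _ (Nat.succ_ne_zero k), mul_left_comm]
      refine mul_le_mul_of_nonneg_left ?_ (hb0 a _ (Nat.succ_ne_zero k))
      obtain ⟨j, hj⟩ : ∃ j, N - k = j + 1 := ⟨N - k - 1, by have := Finset.mem_range.1 hk; omega⟩
      rw [show N + 1 - (k + 1) = j + 1 by omega, hj]
      refine le_trans (le_add_of_nonneg_right ?_) (ih j)
      have hcard : 0 ≤ (S.card : ℝ) * (S.card - 1) / 2 := by
        rcases Nat.eq_zero_or_pos S.card with h | h
        · simp [h]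
        · have : (1 : ℝ) ≤ S.card := by exact_mod_cast h
          have : (0 : ℝ) ≤ S.card - 1 := by linarith
          positivity
      refine mul_nonneg hcard (Finset.sum_nonneg fun i hi => ?_)
      have := Finset.mem_range.1 hi
      exact mul_nonneg (hb0 a _ (by omega)) (hb0 a _ (by omega))
    rw [← Finset.mul_sum] at h1
    have h2 := ih N
    rw [Nat.cast_add, Nat.cast_one, Nat.succ_eq_add_one]
    linear_combination h1 + h2

variable (F) in
lemma le_uncyclicRatio_univ (N : ℕ) :
    (Nat.card F : ℝ) * ((Nat.card F : ℝ)⁻¹ ^ (N + 1) * eulerGap (Nat.card F : ℝ)⁻¹ (N + 1)) +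
      ((Nat.card F : ℝ) * ((Nat.card F : ℝ) - 1) / 2) * ∑ k ∈ Finset.range N,
        ((Nat.card F : ℝ)⁻¹ ^ (k + 1) * eulerGap (Nat.card F : ℝ)⁻¹ (k + 1)) *
          ((Nat.card F : ℝ)⁻¹ ^ (N - k) * eulerGap (Nat.card F : ℝ)⁻¹ (N - k)) ≤
      uncyclicRatio (Set.univ : Set F[X]) (N + 1) := by
  have := Fintype.ofFinite F
  have h := (le_uncyclicRatio_linear
    (fun k => (Nat.card F : ℝ)⁻¹ ^ k * eulerGap (Nat.card F : ℝ)⁻¹ k)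
    (fun a k hk => primaryRatio_X_sub_C a hk) (Finset.univ : Finset F)).2 N
  rw [Finset.card_univ, ← Nat.card_eq_fintype_card] at h
  exact h.trans (uncyclicRatio_mono (Set.subset_univ _) _)

lemma scaledRatio_one : scaledRatio F 1 = 0 := by
  refine le_antisymm ((scaledRatio_le one_ne_zero).trans (le_of_eq ?_)) (scaledRatio_nonneg F 1)
  refine Finset.sum_eq_zero fun g _ => ?_
  rw [Finset.Icc_eq_empty, Finset.sum_empty]
  have := Nat.div_le_self 1 g.natDegree
  omega

-- Only linear polynomials with m = 2 or m = 3 fit in dimension 3, and m = 2 leaves a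
-- one-dimensional uncyclic part, which does not exist.
variable (F) in
lemma scaledRatio_three_le :
    scaledRatio F 3 ≤ Nat.card F * eulerGap (Nat.card F : ℝ)⁻¹ 3 := by
  refine (scaledRatio_le (by norm_num)).trans ?_
  have h : ∀ g ∈ irreducibles F 3, (∑ m ∈ Finset.Icc 2 (3 / g.natDegree),
      eulerGap (((Nat.card F : ℝ) ^ g.natDegree)⁻¹) m * scaledRatio F (3 - m * g.natDegree)) =
      (fun d : ℕ => if d = 1 then eulerGap (Nat.card F : ℝ)⁻¹ 3 else 0) g.natDegree := by
    intro g hg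
    obtain ⟨-, h2, h3⟩ := mem_irreducibles.1 hg
    have h4 := h2.natDegree_pos
    by_cases h1 : g.natDegree = 1
    · rw [h1]
      simp [Finset.sum_Icc_succ_top, scaledRatio_zero, scaledRatio_one]
    · have h5 : 3 / g.natDegree < 2 := by
        rw [Nat.div_lt_iff_lt_mul h4]
        omega
      rw [Finset.Icc_eq_empty (by omega), Finset.sum_empty]
      simp [h1]
  rw [Finset.sum_congr rfl h,
    sum_irreducibles 3 (fun d : ℕ => if d = 1 then eulerGap (Nat.card F : ℝ)⁻¹ 3 else 0)]
  simp [irreducibleCount_one]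

variable (F) in
lemma scaledRatio_three : scaledRatio F 3 = Nat.card F * eulerGap (Nat.card F : ℝ)⁻¹ 3 := by
  refine le_antisymm (scaledRatio_three_le F) ?_
  have hq : (0 : ℝ) < Nat.card F := Nat.cast_pos.2 Nat.card_pos
  have h := le_uncyclicRatio_univ F 2
  -- Every two-eigenvalue product in dimension 3 has a factor with m = 1, so it vanishes.
  have h1 : eulerGap (Nat.card F : ℝ)⁻¹ 1 = 0 := sub_self _
  rw [Finset.sum_range_succ, Finset.sum_range_one] at h
  simp only [zero_add, h1, show 2 - 1 = 1 from rfl, mul_zero, zero_mul, add_zero] at h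
  rw [scaledRatio]
  refine le_trans (le_of_eq ?_) (mul_le_mul_of_nonneg_left h (pow_nonneg hq.le 3))
  have e : (Nat.card F : ℝ) ^ 3 * (Nat.card F : ℝ)⁻¹ ^ (2 + 1) = 1 := by
    rw [inv_pow]; exact mul_inv_cancel₀ (by positivity)
  linear_combination -(Nat.card F : ℝ) * eulerGap (Nat.card F : ℝ)⁻¹ 3 * e

lemma eulerTail_mul_eulerGap_term {x : ℝ} (h0 : 0 < x) (h1 : x ≤ 1 / 2) {k j : ℕ} (hk : 1 ≤ k)
    (hj : 1 ≤ j) : x ^ 4 ≤ eulerTail x (k + j + 1) * ((eulerTail x k)⁻¹ - 1) *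
      ((eulerTail x j)⁻¹ - 1) := by
  have h1' : x < 1 := by linarith
  have hk0 := eulerTail_pos h0 h1' k
  have hj0 := eulerTail_pos h0 h1' j
  have hk1 := eulerTail_le_one_sub_sq h0 h1' hk
  have hj1 := eulerTail_le_one_sub_sq h0 h1' hj
  have hm := eulerTail_mul_le h0 h1 hk hj
  have e : eulerTail x (k + j + 1) * ((eulerTail x k)⁻¹ - 1) * ((eulerTail x j)⁻¹ - 1) =
      eulerTail x (k + j + 1) / (eulerTail x k * eulerTail x j) *
        ((1 - eulerTail x k) * (1 - eulerTail x j)) := by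
    field_simp
  have e1 : 1 ≤ eulerTail x (k + j + 1) / (eulerTail x k * eulerTail x j) :=
    (one_le_div (mul_pos hk0 hj0)).2 hm
  have e2 : x ^ 2 * x ^ 2 ≤ (1 - eulerTail x k) * (1 - eulerTail x j) := by
    have : 0 ≤ x ^ 2 := sq_nonneg x
    apply mul_le_mul <;> linarith
  rw [e]
  calc x ^ 4 = 1 * (x ^ 2 * x ^ 2) := by ring
    _ ≤ _ := mul_le_mul e1 e2 (by positivity) (by linarith)

/-- The one-eigenvalue part is x^N (1 - `eulerTail x N`), which gives x^(N+2) (1 + x - x^3). Each of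
N - 2 two-eigenvalue terms adds at least x^(N+3)/2. -/
lemma euler_mul_lower_bound {q x : ℝ} (hq : 0 < q) (hx : x = q⁻¹) (h1 : x ≤ 1 / 2) {N : ℕ}
    (hN : 3 ≤ N) :
    x ^ (N + 2) * (1 + (N : ℝ) / 2 * x - x ^ 3) <
      euler x (N + 1) * (q * (x ^ (N + 1) * eulerGap x (N + 1)) +
      (q * (q - 1) / 2) * ∑ k ∈ Finset.range N,
        (x ^ (k + 1) * eulerGap x (k + 1)) * (x ^ (N - k) * eulerGap x (N - k))) := by
  have h0 : 0 < x := hx ▸ inv_pos.2 hq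
  have h1' : x < 1 := by linarith
  have hqx : q = x⁻¹ := by rw [hx, inv_inv]
  have hN0 := eulerTail_pos h0 h1' N
  have h2 : 0 < 1 - x := by linarith
  have hmain : euler x (N + 1) * (q * (x ^ (N + 1) * eulerGap x (N + 1))) =
      x ^ N * (1 - eulerTail x N) := by
    rw [euler_succ_eq, eulerGap_succ, hqx]
    field_simp
    ring
  -- The end indices k = 0 and k = N - 1 are left out: there one gap is taken at 1 and is zero.
  have hterm : ∀ k ∈ Finset.Ico 1 (N - 1), x ^ (N + 3) / 2 ≤
      euler x (N + 1) * ((q * (q - 1) / 2) *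
        ((x ^ (k + 1) * eulerGap x (k + 1)) * (x ^ (N - k) * eulerGap x (N - k)))) := by
    intro k hk
    obtain ⟨hk1, hk2⟩ := Finset.mem_Ico.1 hk
    obtain ⟨j, rfl⟩ : ∃ j, N = k + j + 1 := ⟨N - k - 1, by omega⟩
    have hj : 1 ≤ j := by omega
    rw [show k + j + 1 - k = j + 1 by omega, euler_succ_eq, eulerGap_succ, eulerGap_succ, hqx]
    have h3 := eulerTail_mul_eulerGap_term h0 h1 hk1 hj
    have e : (1 - x) * eulerTail x (k + j + 1) * (x⁻¹ * (x⁻¹ - 1) / 2 *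
        (x ^ (k + 1) * ((1 - x)⁻¹ * ((eulerTail x k)⁻¹ - 1)) *
          (x ^ (j + 1) * ((1 - x)⁻¹ * ((eulerTail x j)⁻¹ - 1))))) =
        x ^ (k + j) / 2 * (eulerTail x (k + j + 1) * ((eulerTail x k)⁻¹ - 1) *
          ((eulerTail x j)⁻¹ - 1)) := by
      generalize (eulerTail x k)⁻¹ - 1 = u
      generalize (eulerTail x j)⁻¹ - 1 = v
      rw [show x⁻¹ - 1 = (1 - x) * x⁻¹ by field_simp]
      field_simp
      ring
    rw [e]
    calc x ^ (k + j + 1 + 3) / 2 = x ^ (k + j) / 2 * x ^ 4 := by ring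
      _ ≤ _ := mul_le_mul_of_nonneg_left h3 (by positivity)
  have hsum : ((N : ℝ) - 2) * (x ^ (N + 3) / 2) ≤ euler x (N + 1) * ((q * (q - 1) / 2) *
      ∑ k ∈ Finset.range N,
        (x ^ (k + 1) * eulerGap x (k + 1)) * (x ^ (N - k) * eulerGap x (N - k))) := by
    have hq1 : 0 ≤ q - 1 := by
      have : 1 ≤ q := by rw [hqx]; exact (one_le_inv₀ h0).2 h1'.le
      linarith
    have hE : 0 < euler x (N + 1) := by rw [euler_succ_eq]; positivity
    have hcard := Finset.card_nsmul_le_sum _ _ _ hterm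
    rw [Nat.card_Ico, nsmul_eq_mul, show N - 1 - 1 = N - 2 by omega,
      Nat.cast_sub (by omega), ← Finset.mul_sum, ← Finset.mul_sum] at hcard
    push_cast at hcard
    refine hcard.trans ?_
    refine mul_le_mul_of_nonneg_left (mul_le_mul_of_nonneg_left ?_ (by positivity)) hE.le
    refine Finset.sum_le_sum_of_subset_of_nonneg ?_ fun k hk _ => ?_
    · intro k hk
      have := Finset.mem_Ico.1 hk
      exact Finset.mem_range.2 (by omega)
    · have := Finset.mem_range.1 hk
      have e1 := eulerGap_nonneg h0 h1' (k + 1) (by omega)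
      have e2 := eulerGap_nonneg h0 h1' (N - k) (by omega)
      positivity
  have hT : eulerTail x N ≤ (1 - x ^ 2) * (1 - x ^ 3) * (1 - x ^ 4) := by
    have := eulerTail_antitone h0 h1' hN
    simpa [eulerTail, Finset.prod_range_succ] using this
  -- Strictness comes from the third factor 1 - x^4 of the tail, present because N ≥ 3.
  have hlt : x ^ 2 + x ^ 3 - x ^ 5 < 1 - eulerTail x N := by
    have e1 : x ^ 2 < 1 := pow_lt_one₀ h0.le h1' (by norm_num)
    have e2 : x ^ 3 < 1 := pow_lt_one₀ h0.le h1' (by norm_num)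
    have e3 : 0 < x ^ 4 * ((1 - x ^ 2) * (1 - x ^ 3)) :=
      mul_pos (by positivity) (mul_pos (by linarith) (by linarith))
    nlinarith
  have hlt' := mul_lt_mul_of_pos_left hlt (pow_pos h0 N)
  rw [mul_add, hmain]
  refine lt_of_lt_of_le ?_ (add_le_add_right hsum _)
  have e : x ^ (N + 2) * (1 + (N : ℝ) / 2 * x - x ^ 3) =
      x ^ N * (x ^ 2 + x ^ 3 - x ^ 5) + ((N : ℝ) - 2) * (x ^ (N + 3) / 2) := by
    ring
  rw [e]
  linarith

end LowerBound

/-! ### The upper bound from a uniform gap bound per degree. -/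

section UpperBound

lemma geom_sum_le {s : ℝ} (h0 : 0 ≤ s) (h1 : s < 1) (n : ℕ) :
    ∑ k ∈ Finset.range n, s ^ k ≤ 1 / (1 - s) := by
  rw [le_div_iff₀ (by linarith), mul_comm, mul_neg_geom_sum]
  have := pow_nonneg h0 n
  linarith

lemma sum_Icc_pow_le {s : ℝ} (h0 : 0 ≤ s) (h1 : s < 1) (a b : ℕ) :
    ∑ k ∈ Finset.Icc a b, s ^ k ≤ s ^ a / (1 - s) := by
  rw [← Finset.Ico_add_one_right_eq_Icc, Finset.sum_Ico_eq_sum_range]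
  simp_rw [pow_add]
  rw [← Finset.mul_sum, div_eq_mul_one_div]
  exact mul_le_mul_of_nonneg_left (geom_sum_le h0 h1 _) (pow_nonneg h0 a)

lemma sum_Icc_le_add {f : ℕ → ℝ} {a : ℕ} (hf : ∀ m, a ≤ m → 0 ≤ f m) (j M : ℕ) :
    ∑ m ∈ Finset.Icc a M, f m ≤
      ∑ m ∈ Finset.Ico a (a + j), f m + ∑ m ∈ Finset.Icc (a + j) (a + j + M), f m := by
  rw [← Finset.Ico_add_one_right_eq_Icc (a + j),
    Finset.sum_Ico_consecutive f (by omega) (by omega), Finset.Ico_add_one_right_eq_Icc]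
  exact Finset.sum_le_sum_of_subset_of_nonneg (Finset.Icc_subset_Icc le_rfl (by omega))
    fun m hm _ => hf m (Finset.mem_Icc.1 hm).1

variable (F : Type*) [Field F] [Finite F]

/-- Degrees 1 and 2 use the counts q and (q^2 - q)/2. From degree 3 on the count is at most q^d/3,
and the rest is a geometric series. -/
lemma sum_irreducibles_le (n : ℕ) {f : ℕ → ℝ} (hf : ∀ d, 1 ≤ d → 0 ≤ f d) {A r : ℝ} (hA : 0 ≤ A)
    (hr : 0 ≤ r) (hr1 : (Nat.card F : ℝ) * r < 1) (hfA : ∀ d, 3 ≤ d → f d ≤ A * r ^ d) :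
    ∑ g ∈ irreducibles F n, f g.natDegree ≤ Nat.card F * f 1 +
      ((Nat.card F : ℝ) ^ 2 - Nat.card F) / 2 * f 2 +
      A / 3 * ((Nat.card F * r) ^ 3 / (1 - Nat.card F * r)) := by
  have hq : (0 : ℝ) ≤ Nat.card F := Nat.cast_nonneg _
  have hN : ∀ d, 2 ≤ d → (irreducibleCount F d : ℝ) ≤ ((Nat.card F : ℝ) ^ d - Nat.card F) / d := by
    intro d hd
    have h1 : ((d * irreducibleCount F d + Nat.card F : ℕ) : ℝ) ≤ ((Nat.card F ^ d : ℕ) : ℝ) :=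
      Nat.cast_le.2 (irreducibleCount_le F hd)
    push_cast at h1
    rw [le_div_iff₀ (by exact_mod_cast (by omega : 0 < d))]
    linarith
  rw [sum_irreducibles]
  refine (sum_Icc_le_add (fun d hd => mul_nonneg (Nat.cast_nonneg _) (hf d hd)) 2 n).trans ?_
  refine add_le_add ?_ ?_
  · rw [show 1 + 2 = 1 + 1 + 1 from rfl, Finset.sum_Ico_succ_top (by omega),
      Finset.sum_Ico_succ_top (by omega), Finset.Ico_self, Finset.sum_empty, zero_add,
      irreducibleCount_one]
    have h2 := mul_le_mul_of_nonneg_right (hN 2 le_rfl) (hf 2 (by norm_num))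
    push_cast at h2
    linarith
  · rw [show 1 + 2 = 3 from rfl]
    refine le_trans ?_ (mul_le_mul_of_nonneg_left
      (sum_Icc_pow_le (mul_nonneg hq hr) hr1 3 (3 + n)) (by positivity))
    rw [Finset.mul_sum]
    refine Finset.sum_le_sum fun d hd => ?_
    have hd3 := (Finset.mem_Icc.1 hd).1
    have h3 : (irreducibleCount F d : ℝ) ≤ (Nat.card F : ℝ) ^ d / 3 := by
      refine (hN d (by omega)).trans ?_
      refine div_le_div₀ (by positivity) (by linarith) (by norm_num) (by exact_mod_cast hd3)
    calc (irreducibleCount F d : ℝ) * f d ≤ (Nat.card F : ℝ) ^ d / 3 * (A * r ^ d) :=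
          mul_le_mul h3 (hfA d hd3) (hf d (by omega)) (by positivity)
      _ = A / 3 * (Nat.card F * r) ^ d := by rw [mul_pow]; ring

variable {F}

/-- For a fixed `g` the indices n - m deg g with m ≥ 2 are distinct and at most n - 2, so the inner
sum is at most the full initial sum. -/
lemma scaledRatio_le_mul_sum {f : ℕ → ℝ} {e : ℝ}
    (hf : ∀ d m : ℕ, 1 ≤ d → 1 ≤ m → eulerGap (((Nat.card F : ℝ) ^ d)⁻¹) m ≤ f d)
    (hf0 : ∀ d, 1 ≤ d → 0 ≤ f d)
    (he : ∀ n, ∑ g ∈ irreducibles F n, f g.natDegree ≤ e) {n : ℕ} (hn : n ≠ 0) :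
    scaledRatio F n ≤ e * ∑ i ∈ Finset.range (n - 1), scaledRatio F i := by
  refine (scaledRatio_le hn).trans ?_
  have hS : 0 ≤ ∑ i ∈ Finset.range (n - 1), scaledRatio F i :=
    Finset.sum_nonneg fun i _ => scaledRatio_nonneg F i
  refine le_trans ?_ (mul_le_mul_of_nonneg_right (he n) hS)
  rw [Finset.sum_mul]
  refine Finset.sum_le_sum fun g hg => ?_
  obtain ⟨-, h2, -⟩ := mem_irreducibles.1 hg
  have hd : 1 ≤ g.natDegree := h2.natDegree_pos
  have h3 : ∑ m ∈ Finset.Icc 2 (n / g.natDegree), scaledRatio F (n - m * g.natDegree) ≤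
      ∑ i ∈ Finset.range (n - 1), scaledRatio F i := by
    have hmem : ∀ m ∈ Finset.Icc 2 (n / g.natDegree), 2 ≤ m ∧ m * g.natDegree ≤ n := fun m hm =>
      ⟨(Finset.mem_Icc.1 hm).1, (Nat.le_div_iff_mul_le hd).1 (Finset.mem_Icc.1 hm).2⟩
    have hinj : Set.InjOn (fun m => n - m * g.natDegree)
        (Finset.Icc 2 (n / g.natDegree) : Finset ℕ) := by
      intro a ha b hb hab
      have h4 := (hmem a ha).2
      have h5 := (hmem b hb).2
      have h6 : n - a * g.natDegree = n - b * g.natDegree := hab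
      exact Nat.eq_of_mul_eq_mul_right hd (by omega)
    rw [← Finset.sum_image (f := scaledRatio F) hinj]
    refine Finset.sum_le_sum_of_subset_of_nonneg ?_ fun i _ _ => scaledRatio_nonneg F i
    intro i hi
    obtain ⟨m, hm, rfl⟩ := Finset.mem_image.1 hi
    obtain ⟨h4, h5⟩ := hmem m hm
    have h6 : 2 * 1 ≤ m * g.natDegree := Nat.mul_le_mul h4 hd
    exact Finset.mem_range.2 (by omega)
  refine le_trans ?_ (mul_le_mul_of_nonneg_left h3 (hf0 _ hd))
  rw [Finset.mul_sum]
  refine Finset.sum_le_sum fun m hm => ?_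
  exact mul_le_mul_of_nonneg_right (hf _ _ hd (by have := (Finset.mem_Icc.1 hm).1; omega))
    (scaledRatio_nonneg F _)

/-- Growth bound from the recursion `U n ≤ e (U 0 + ⋯ + U (n - 2))`. -/
lemma scaledRatio_le_pow {e ρ : ℝ} (he0 : 0 ≤ e) (hρ : 1 ≤ ρ) (heρ : e ≤ ρ ^ 2 - ρ)
    (he : ∀ n, n ≠ 0 → scaledRatio F n ≤ e * ∑ i ∈ Finset.range (n - 1), scaledRatio F i) (n : ℕ) :
    scaledRatio F (n + 2) ≤ e * ρ ^ n := by
  -- Partial sums are dominated by powers of ρ. Two consecutive bounds are carried because the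
  -- recursion skips one index; the start uses U 1 = 0.
  have hS : ∀ n, ∑ i ∈ Finset.range (n + 1), scaledRatio F i ≤ ρ ^ n ∧
      ∑ i ∈ Finset.range (n + 2), scaledRatio F i ≤ ρ ^ (n + 1) := by
    intro n
    induction n with
    | zero =>
      constructor
      · simp [scaledRatio_zero]
      · rw [Finset.sum_range_succ, Finset.sum_range_one, scaledRatio_zero, scaledRatio_one]
        simpa using hρ
    | succ n ih =>
      refine ⟨ih.2, ?_⟩
      rw [Finset.sum_range_succ]
      have h1 := he (n + 2) (by omega)
      rw [show n + 2 - 1 = n + 1 by omega] at h1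
      have h2 := mul_le_mul_of_nonneg_left ih.1 he0
      have h3 := mul_le_mul_of_nonneg_right heρ (pow_nonneg (zero_le_one.trans hρ) n)
      have h4 : (ρ ^ 2 - ρ) * ρ ^ n = ρ ^ (n + 2) - ρ ^ (n + 1) := by ring
      rw [show n + 1 + 1 = n + 2 from rfl]
      linarith [ih.2]
  have h1 := he (n + 2) (by omega)
  rw [show n + 2 - 1 = n + 1 by omega] at h1
  exact h1.trans (mul_le_mul_of_nonneg_left (hS n).1 he0)

lemma unc_div_eq_scaledRatio (F : Type*) [Field F] [Fintype F] (n : ℕ) :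
    (unc n F : ℝ) / (Nat.card F : ℝ) ^ (n ^ 2) =
      euler (Nat.card F : ℝ)⁻¹ n * ((Nat.card F : ℝ)⁻¹ ^ n * scaledRatio F n) := by
  have hq : (0 : ℝ) < Nat.card F := Nat.cast_pos.2 Nat.card_pos
  rw [unc_div_eq, scaledRatio, inv_pow, inv_mul_cancel_left₀ (by positivity)]

lemma euler_le_one_sub {x : ℝ} (h0 : 0 < x) (h1 : x < 1) {n : ℕ} (hn : n ≠ 0) :
    euler x n ≤ 1 - x := by
  obtain ⟨k, rfl⟩ := Nat.exists_eq_succ_of_ne_zero hn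
  rw [Nat.succ_eq_add_one, euler_succ_eq]
  have := eulerTail_le_one h0 h1 k
  nlinarith

/-- The upper bound for `q ≥ 3`, given a bound `E` for `eulerGap q⁻¹`. -/
lemma unc_div_le {F : Type*} [Field F] [Fintype F] {x E ρ : ℝ} (hx : x = (Nat.card F : ℝ)⁻¹)
    (hq : x ≤ 1 / 3) (hE0 : 0 ≤ E) (hE : ∀ m : ℕ, 1 ≤ m → eulerGap x m ≤ E) (hρ : 1 ≤ ρ)
    (heρ : x⁻¹ * E + (1 - x) / 2 * x ^ 2 * (1 + 2 * x ^ 2 + 6.6 * x ^ 4) +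
      1.084 / 3 * (x ^ 3 / (1 - x)) ≤ ρ ^ 2 - ρ) (n : ℕ) :
    (unc (n + 2) F : ℝ) / (Nat.card F : ℝ) ^ ((n + 2) ^ 2) ≤
      (1 - x) * ((ρ - 1) / ρ) * (x * ρ) ^ (n + 2) := by
  have h0 : 0 < x := hx ▸ inv_natCard_pos F
  have hqx : (Nat.card F : ℝ) = x⁻¹ := by rw [hx, inv_inv]
  have hxx : (Nat.card F : ℝ) * x ^ 2 = x := by rw [hqx]; field_simp
  let G : ℝ → ℝ := fun y => y ^ 2 * (1 + 2 * y + 6.6 * y ^ 2)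
  let f : ℕ → ℝ := fun d => if d = 1 then E else G (x ^ d)
  have hf1 : f 1 = E := if_pos rfl
  have hf2 : ∀ d, 2 ≤ d → f d = G (x ^ d) := fun d hd => if_neg (by omega)
  have hG0 : ∀ y, 0 < y → 0 ≤ G y := fun y hy => by positivity
  have hf0 : ∀ d, 1 ≤ d → 0 ≤ f d := by
    intro d hd
    rcases hd.eq_or_lt with rfl | hd
    · rw [hf1]; exact hE0
    · rw [hf2 d hd]; exact hG0 _ (pow_pos h0 d)
  have hfgap : ∀ d m : ℕ, 1 ≤ d → 1 ≤ m → eulerGap (((Nat.card F : ℝ) ^ d)⁻¹) m ≤ f d := by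
    intro d m hd hm
    rw [← inv_pow, ← hx]
    rcases hd.eq_or_lt with rfl | hd
    · rw [hf1, pow_one]; exact hE m hm
    · rw [hf2 d hd]
      refine eulerGap_le (pow_pos h0 d) ?_ (by omega)
      calc x ^ d ≤ x ^ 2 := pow_le_pow_of_le_one h0.le (by linarith) hd
        _ ≤ (1 / 3) ^ 2 := pow_le_pow_left₀ h0.le hq 2
        _ ≤ 1 / 4 := by norm_num
  -- For x^d ≤ 1/27 the bracket is at most 1 + 2/27 + 6.6/729 < 1.084.
  have hfA : ∀ d, 3 ≤ d → f d ≤ 1.084 * (x ^ 2) ^ d := by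
    intro d hd
    rw [hf2 d (by omega)]
    have h1 : x ^ d ≤ 1 / 27 :=
      calc x ^ d ≤ x ^ 3 := pow_le_pow_of_le_one h0.le (by linarith) hd
        _ ≤ (1 / 3) ^ 3 := pow_le_pow_left₀ h0.le hq 3
        _ = 1 / 27 := by norm_num
    have h2 : 0 < x ^ d := pow_pos h0 d
    have h3 : (x ^ 2) ^ d = (x ^ d) ^ 2 := by rw [← pow_mul, mul_comm, pow_mul]
    rw [h3, mul_comm]
    exact mul_le_mul_of_nonneg_left (by nlinarith) (sq_nonneg (x ^ d))
  have hsum : ∀ n, ∑ g ∈ irreducibles F n, f g.natDegree ≤ ρ ^ 2 - ρ := by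
    intro n
    refine (sum_irreducibles_le F n hf0 (by norm_num) (sq_nonneg x)
      (by rw [hxx]; linarith) hfA).trans (le_trans (le_of_eq ?_) heρ)
    rw [hxx, hf1, hf2 2 le_rfl, hqx]
    simp only [G]
    field_simp
  -- Taking e = ρ^2 - ρ exactly turns e ρ^n into ((ρ - 1)/ρ) ρ^(n+2).
  have hU := scaledRatio_le_pow (F := F) (by nlinarith) hρ le_rfl
    (fun n hn => scaledRatio_le_mul_sum hfgap hf0 hsum hn) n
  rw [unc_div_eq_scaledRatio, ← hx]
  have hρ0 : ρ ≠ 0 := by positivity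
  calc euler x (n + 2) * (x ^ (n + 2) * scaledRatio F (n + 2))
      ≤ (1 - x) * (x ^ (n + 2) * ((ρ ^ 2 - ρ) * ρ ^ n)) :=
        mul_le_mul (euler_le_one_sub h0 (by linarith) (by omega))
          (mul_le_mul_of_nonneg_left hU (by positivity))
          (mul_nonneg (by positivity) (scaledRatio_nonneg F _)) (by linarith)
    _ = _ := by
      rw [mul_pow]
      field_simp
      ring

end UpperBound

/-! ### The upper bound over the field with two elements. -/

section Binary

/-- An upper bound for `eulerGap y m`, valid for `y ≤ 1 / 4`. -/
noncomputable def gapBound (y : ℝ) : ℝ := y ^ 2 * (1 + 2 * y + 6.6 * y ^ 2)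

lemma gapBound_nonneg {y : ℝ} (hy : 0 ≤ y) : 0 ≤ gapBound y := by
  unfold gapBound; positivity

/-- An upper bound for `∑ m ≥ 2, eulerGap (1 / 2) m * t ^ m`. -/
noncomputable def linearWeight (t : ℝ) : ℝ :=
  ∑ m ∈ Finset.Ico 2 7, eulerGap (1 / 2) m * t ^ m + 1.4632 * (t ^ 7 / (1 - t))

/-- An upper bound for `∑ m ≥ 2, eulerGap (1 / 2 ^ d) m * t ^ (d * m)`. -/
noncomputable def binaryWeight (t : ℝ) (d : ℕ) : ℝ :=
  if d = 1 then linearWeight t else gapBound ((1 / 2) ^ d) * ((t ^ d) ^ 2 / (1 - t ^ d))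

/-- The gaps increase to about 1.4627; five tail factors locate the limit closely enough. -/
lemma eulerGap_half_le {m : ℕ} (hm : m ≠ 0) : eulerGap (1 / 2) m ≤ 1.4632 := by
  refine eulerGap_le_of_le_eulerTail (by norm_num)
    (L := eulerTail (1 / 2) 5 * (1 - (1 / 2) ^ (5 + 2) / (1 - 1 / 2)))
    (fun k => le_eulerTail (by norm_num) le_rfl 5 k) ?_ ?_ hm
  · simp only [eulerTail, Finset.prod_range_succ, Finset.prod_range_zero]
    norm_num
  · simp only [eulerTail, Finset.prod_range_succ, Finset.prod_range_zero]
    norm_num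

lemma linearWeight_nonneg {t : ℝ} (h0 : 0 ≤ t) (h1 : t < 1) : 0 ≤ linearWeight t := by
  refine add_nonneg (Finset.sum_nonneg fun m hm => ?_)
    (mul_nonneg (by norm_num) (div_nonneg (pow_nonneg h0 _) (by linarith)))
  refine mul_nonneg (eulerGap_nonneg (by norm_num) (by norm_num) m ?_) (pow_nonneg h0 m)
  have := (Finset.mem_Ico.1 hm).1
  omega

lemma binaryWeight_nonneg {t : ℝ} (h0 : 0 ≤ t) (h1 : t < 1) {d : ℕ} (hd : 1 ≤ d) :
    0 ≤ binaryWeight t d := by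
  unfold binaryWeight
  split_ifs
  · exact linearWeight_nonneg h0 h1
  · have : t ^ d < 1 := pow_lt_one₀ h0 h1 (by omega)
    exact mul_nonneg (gapBound_nonneg (by positivity)) (div_nonneg (by positivity) (by linarith))

/-- In degree 1 the gaps for m = 2, ..., 6 are kept exactly and only the rest is bounded by a
geometric series; in higher degrees one gap bound suffices. -/
lemma sum_eulerGap_le_binaryWeight {t : ℝ} (h0 : 0 ≤ t) (h1 : t < 1) {d : ℕ} (hd : 1 ≤ d) (M : ℕ) :
    ∑ m ∈ Finset.Icc 2 M, eulerGap ((1 / 2) ^ d) m * (t ^ d) ^ m ≤ binaryWeight t d := by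
  rcases hd.eq_or_lt with rfl | hd
  · rw [binaryWeight, if_pos rfl, pow_one, pow_one]
    refine (sum_Icc_le_add (a := 2) (fun m hm => mul_nonneg (eulerGap_nonneg (by norm_num)
      (by norm_num) m (by omega)) (pow_nonneg h0 m)) 5 M).trans ?_
    refine add_le_add_right ?_ _
    refine le_trans ?_ (mul_le_mul_of_nonneg_left (sum_Icc_pow_le h0 h1 7 (7 + M)) (by norm_num))
    rw [Finset.mul_sum]
    refine Finset.sum_le_sum fun m hm => mul_le_mul_of_nonneg_right (eulerGap_half_le ?_)
      (pow_nonneg h0 m)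
    have := (Finset.mem_Icc.1 hm).1
    omega
  · rw [binaryWeight, if_neg (by omega)]
    have hd0 : 0 ≤ t ^ d := pow_nonneg h0 d
    have hd1 : t ^ d < 1 := pow_lt_one₀ h0 h1 (by omega)
    refine le_trans ?_ (mul_le_mul_of_nonneg_left (sum_Icc_pow_le hd0 hd1 2 M)
      (gapBound_nonneg (by positivity)))
    rw [Finset.mul_sum]
    refine Finset.sum_le_sum fun m hm => mul_le_mul_of_nonneg_right ?_ (pow_nonneg hd0 m)
    refine eulerGap_le (by positivity) ?_ ?_
    · calc ((1 : ℝ) / 2) ^ d ≤ (1 / 2) ^ 2 := pow_le_pow_of_le_one (by norm_num) (by norm_num) hd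
        _ ≤ 1 / 4 := by norm_num
    · have := (Finset.mem_Icc.1 hm).1
      omega

lemma binaryWeight_le {t : ℝ} (h0 : 0 ≤ t) (h1 : t < 1) {d : ℕ} (hd : 3 ≤ d) :
    binaryWeight t d ≤ 1.354 / (1 - t ^ 3) * (t ^ 2 / 4) ^ d := by
  rw [binaryWeight, if_neg (by omega)]
  have h3 : t ^ d ≤ t ^ 3 := pow_le_pow_of_le_one h0 h1.le hd
  have h4 : t ^ 3 < 1 := pow_lt_one₀ h0 h1 (by norm_num)
  have h5 : ((1 : ℝ) / 2) ^ d ≤ 1 / 8 := by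
    calc ((1 : ℝ) / 2) ^ d ≤ (1 / 2) ^ 3 := pow_le_pow_of_le_one (by norm_num) (by norm_num) hd
      _ = 1 / 8 := by norm_num
  have h6 : (0 : ℝ) ≤ (1 / 2) ^ d := by positivity
  -- For y ≤ 1/8 the bracket is at most 1 + 2/8 + 6.6/64 < 1.354.
  have h7 : gapBound ((1 / 2) ^ d) ≤ ((1 / 2) ^ d) ^ 2 * 1.354 :=
    mul_le_mul_of_nonneg_left (by nlinarith) (sq_nonneg _)
  have h8 : (t ^ d) ^ 2 / (1 - t ^ d) ≤ (t ^ d) ^ 2 / (1 - t ^ 3) :=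
    div_le_div_of_nonneg_left (sq_nonneg _) (by linarith) (by linarith)
  refine (mul_le_mul h7 h8 (div_nonneg (sq_nonneg _) (by linarith)) (by positivity)).trans
    (le_of_eq ?_)
  rw [show t ^ 2 / 4 = (1 / 2 * t) ^ 2 by ring, pow_right_comm, mul_pow _ t]
  ring

/-- The three parts are at most 0.983, 0.0115 and 0.0015. The base 1.966 = 2 · 0.983 is dictated by
the target rate. -/
lemma binaryWeight_total :
    2 * binaryWeight 1.966⁻¹ 1 + (2 ^ 2 - 2) / 2 * binaryWeight 1.966⁻¹ 2 +
      1.354 / (1 - 1.966⁻¹ ^ 3) / 3 *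
        ((2 * (1.966⁻¹ ^ 2 / 4)) ^ 3 / (1 - 2 * (1.966⁻¹ ^ 2 / 4))) ≤ 1 := by
  have h1 : binaryWeight 1.966⁻¹ 1 ≤ 0.4915 := by
    rw [binaryWeight, if_pos rfl, linearWeight]
    simp only [Finset.sum_Ico_succ_top, eulerGap, euler, Finset.prod_range_succ,
      Finset.prod_range_zero, Nat.reduceLeDiff, Finset.Ico_self, Finset.sum_empty]
    norm_num
  have h2 : binaryWeight 1.966⁻¹ 2 ≤ 0.0115 := by
    rw [binaryWeight, if_neg (by norm_num), gapBound]
    norm_num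
  have h3 : (1.354 : ℝ) / (1 - 1.966⁻¹ ^ 3) / 3 *
        ((2 * (1.966⁻¹ ^ 2 / 4)) ^ 3 / (1 - 2 * (1.966⁻¹ ^ 2 / 4))) ≤ 0.0015 := by norm_num
  linarith

/-- Strong induction: inserting 1.966^j into the recursion gives 1.966^n times a total weight of at
most 1. A uniform gap bound of 1.4632 for the two linear polynomials would force ρ > 2, which gives
no decay. -/
lemma scaledRatio_le_of_natCard_eq_two {F : Type*} [Field F] [Finite F] (hF : Nat.card F = 2)
    (n : ℕ) : scaledRatio F n ≤ 1.966 ^ n := by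
  have hq : (Nat.card F : ℝ) = 2 := by rw [hF]; norm_num
  induction n using Nat.strong_induction_on with
  | _ n ih =>
    rcases eq_or_ne n 0 with rfl | hn
    · rw [scaledRatio_zero, pow_zero]
    refine (scaledRatio_le hn).trans ?_
    have ht0 : (0 : ℝ) ≤ 1.966⁻¹ := by norm_num
    have ht1 : (1.966⁻¹ : ℝ) < 1 := by norm_num
    have hterm : ∀ g ∈ irreducibles F n, (∑ m ∈ Finset.Icc 2 (n / g.natDegree),
        eulerGap (((Nat.card F : ℝ) ^ g.natDegree)⁻¹) m * scaledRatio F (n - m * g.natDegree)) ≤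
          1.966 ^ n * binaryWeight 1.966⁻¹ g.natDegree := by
      intro g hg
      obtain ⟨-, h2, -⟩ := mem_irreducibles.1 hg
      have hd : 1 ≤ g.natDegree := h2.natDegree_pos
      refine le_trans ?_ (mul_le_mul_of_nonneg_left
        (sum_eulerGap_le_binaryWeight ht0 ht1 hd (n / g.natDegree)) (by positivity))
      rw [Finset.mul_sum]
      refine Finset.sum_le_sum fun m hm => ?_
      have hm2 := (Finset.mem_Icc.1 hm).1
      have hmn : m * g.natDegree ≤ n := (Nat.le_div_iff_mul_le hd).1 (Finset.mem_Icc.1 hm).2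
      have h5 : 2 * 1 ≤ m * g.natDegree := Nat.mul_le_mul hm2 hd
      have h6 : ((1.966 : ℝ)) ^ (n - m * g.natDegree) = 1.966 ^ n * (1.966⁻¹ ^ g.natDegree) ^ m := by
        rw [← pow_mul, mul_comm g.natDegree m, inv_pow, ← pow_sub₀ _ (by norm_num) hmn]
      rw [hq, ← inv_pow, ← one_div, mul_left_comm, ← h6]
      refine mul_le_mul_of_nonneg_left (ih _ (by omega))
        (eulerGap_nonneg (by positivity) (pow_lt_one₀ (by norm_num) (by norm_num) (by omega)) m
          (by omega))
    refine (Finset.sum_le_sum hterm).trans ?_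
    rw [← Finset.mul_sum]
    refine mul_le_of_le_one_right (by positivity) ?_
    refine (sum_irreducibles_le F n (A := 1.354 / (1 - 1.966⁻¹ ^ 3)) (r := 1.966⁻¹ ^ 2 / 4)
      (fun d hd => binaryWeight_nonneg ht0 ht1 hd) (by norm_num) (by norm_num)
      (by rw [hq]; norm_num) (fun d hd => binaryWeight_le ht0 ht1 hd)).trans ?_
    rw [hq]
    exact binaryWeight_total

end Binary

/-! ### Assembly and numerical choices. -/

section Main

variable {F : Type*} [Field F] [Fintype F]

lemma unc_three_div_eq : (unc 3 F : ℝ) / (Nat.card F : ℝ) ^ (3 ^ 2) =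
    (Nat.card F : ℝ)⁻¹ ^ 4 * (1 + (Nat.card F : ℝ)⁻¹ - (Nat.card F : ℝ)⁻¹ ^ 3) := by
  rw [unc_div_eq_scaledRatio, scaledRatio_three]
  have h0 := inv_natCard_pos F
  have h1 := inv_natCard_le_half F
  have hq : (Nat.card F : ℝ) = ((Nat.card F : ℝ)⁻¹)⁻¹ := (inv_inv _).symm
  generalize (Nat.card F : ℝ)⁻¹ = x at *
  rw [hq]
  simp only [eulerGap, euler, Finset.prod_range_succ, Finset.prod_range_zero, zero_add, one_mul,
    pow_one]
  have e1 : 1 - x ≠ 0 := by linarith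
  have e2 : 1 - x ^ 2 ≠ 0 := by nlinarith
  have e3 : 1 - x ^ 3 ≠ 0 := by nlinarith [pow_pos h0 2]
  field_simp
  ring

lemma lt_unc_div {n : ℕ} (hn : 4 ≤ n) :
    (Nat.card F : ℝ)⁻¹ ^ (n + 1) *
      (1 + ((n : ℝ) - 1) / 2 * (Nat.card F : ℝ)⁻¹ - (Nat.card F : ℝ)⁻¹ ^ 3) <
        (unc n F : ℝ) / (Nat.card F : ℝ) ^ (n ^ 2) := by
  obtain ⟨N, rfl⟩ : ∃ N, n = N + 1 := ⟨n - 1, by omega⟩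
  have hx0 := inv_natCard_pos F
  have hx1 := inv_natCard_le_half F
  rw [unc_div_eq]
  have h := euler_mul_lower_bound (q := (Nat.card F : ℝ)) (Nat.cast_pos.2 Nat.card_pos) rfl hx1
    (N := N) (by omega)
  push_cast
  rw [add_sub_cancel_right]
  refine h.trans_le (mul_le_mul_of_nonneg_left (le_uncyclicRatio_univ F N) ?_)
  rw [euler_succ_eq]
  exact mul_nonneg (by linarith) (eulerTail_pos hx0 (by linarith) N).le

lemma unc_div_lt_of_four_le (hF : 4 ≤ Nat.card F) {n : ℕ} (hn : 2 ≤ n) :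
    (unc n F : ℝ) / (Nat.card F : ℝ) ^ (n ^ 2) < 2 * (Nat.card F : ℝ)⁻¹ *
      ((Nat.card F : ℝ)⁻¹ + (Nat.card F : ℝ)⁻¹ ^ 2 + 2 * (Nat.card F : ℝ)⁻¹ ^ 3) ^ n := by
  obtain ⟨k, rfl⟩ := Nat.exists_eq_add_of_le' hn
  have h0 := inv_natCard_pos F
  have h1 : (Nat.card F : ℝ)⁻¹ ≤ 1 / 4 := by
    rw [one_div]
    exact inv_anti₀ (by norm_num) (by exact_mod_cast hF)
  -- ρ is chosen so that xρ = x + x^2 + 2x^3; then ρ^2 - ρ = x + 3x^2 + 4x^3 + 4x^4, with room in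
  -- the quadratic term for the irreducibles of degree 2 and more.
  have h := unc_div_le (F := F) rfl (by linarith)
    (gapBound_nonneg h0.le) (fun m hm => eulerGap_le h0 h1 (by omega))
    (ρ := 1 + (Nat.card F : ℝ)⁻¹ + 2 * (Nat.card F : ℝ)⁻¹ ^ 2) (by nlinarith) ?_ k
  · refine h.trans_lt ?_
    generalize (Nat.card F : ℝ)⁻¹ = x at h0 h1 ⊢
    have e : x * (1 + x + 2 * x ^ 2) = x + x ^ 2 + 2 * x ^ 3 := by ring
    rw [e]
    refine mul_lt_mul_of_pos_right ?_ (by positivity)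
    rw [mul_div_assoc', div_lt_iff₀ (by positivity)]
    nlinarith [pow_pos h0 2, pow_pos h0 3]
  · generalize (Nat.card F : ℝ)⁻¹ = x at h0 h1 ⊢
    have e1 : x⁻¹ * gapBound x = x * (1 + 2 * x + 6.6 * x ^ 2) := by
      unfold gapBound
      field_simp
    have e2 : x ^ 3 / (1 - x) ≤ x ^ 3 * (4 / 3) := by
      rw [div_le_iff₀ (by linarith), mul_assoc]
      exact le_mul_of_one_le_right (by positivity) (by linarith)
    -- x ≤ 1/4 gives 1 + 2/16 + 6.6/256 < 1.151.
    have e3 : (1 - x) / 2 * x ^ 2 * (1 + 2 * x ^ 2 + 6.6 * x ^ 4) ≤ (1 - x) / 2 * x ^ 2 * 1.151 := by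
      refine mul_le_mul_of_nonneg_left ?_ (mul_nonneg (by linarith) (sq_nonneg x))
      have : x ^ 2 ≤ 1 / 16 := by nlinarith
      nlinarith
    have e4 : x ^ 3 ≤ x ^ 2 * (1 / 4) := by
      rw [pow_succ]
      exact mul_le_mul_of_nonneg_left h1 (sq_nonneg x)
    have e5 : 0 ≤ x ^ 4 := by positivity
    have e6 : 0 ≤ x ^ 3 := by positivity
    rw [e1]
    nlinarith

lemma unc_div_lt_of_eq_three (hF : Nat.card F = 3) {n : ℕ} (hn : 2 ≤ n) :
    (unc n F : ℝ) / (Nat.card F : ℝ) ^ (n ^ 2) < 0.52 * 0.53 ^ n := by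
  obtain ⟨k, rfl⟩ := Nat.exists_eq_add_of_le' hn
  have hx : (1 / 3 : ℝ) = (Nat.card F : ℝ)⁻¹ := by rw [hF]; norm_num
  have hE : ∀ m : ℕ, 1 ≤ m → eulerGap (1 / 3) m ≤ 0.286 := by
    intro m hm
    refine eulerGap_le_of_le_eulerTail (by norm_num)
      (L := eulerTail (1 / 3) 2 * (1 - (1 / 3) ^ (2 + 2) / (1 - 1 / 3)))
      (fun k => le_eulerTail (by norm_num) (by norm_num) 2 k) ?_ ?_ (by omega)
    · simp only [eulerTail, Finset.prod_range_succ, Finset.prod_range_zero]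
      norm_num
    · simp only [eulerTail, Finset.prod_range_succ, Finset.prod_range_zero]
      norm_num
  -- ρ = 1.59 is three times the rate 0.53; the recursion coefficient is about 0.926, below ρ^2 - ρ
  -- = 0.9381.
  refine (unc_div_le hx le_rfl (by norm_num) hE (ρ := 1.59) (by norm_num) (by norm_num) k).trans_lt
    ?_
  rw [show (1 / 3 * 1.59 : ℝ) = 0.53 by norm_num]
  exact mul_lt_mul_of_pos_right (by norm_num) (by positivity)

lemma unc_div_lt_of_eq_two (hF : Nat.card F = 2) {n : ℕ} (hn : n ≠ 0) :
    (unc n F : ℝ) / (Nat.card F : ℝ) ^ (n ^ 2) < 0.915 * 0.983 ^ n := by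
  have hx : (Nat.card F : ℝ)⁻¹ = 1 / 2 := by rw [hF]; norm_num
  rw [unc_div_eq_scaledRatio, hx]
  calc euler (1 / 2) n * ((1 / 2) ^ n * scaledRatio F n)
      ≤ (1 - 1 / 2) * ((1 / 2) ^ n * 1.966 ^ n) :=
        mul_le_mul (euler_le_one_sub (by norm_num) (by norm_num) hn)
          (mul_le_mul_of_nonneg_left (scaledRatio_le_of_natCard_eq_two hF n) (by positivity))
          (mul_nonneg (by positivity) (scaledRatio_nonneg F n)) (by norm_num)
    _ = (1 - 1 / 2) * 0.983 ^ n := by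
      rw [← mul_pow]
      norm_num
    _ < 0.915 * 0.983 ^ n := mul_lt_mul_of_pos_right (by norm_num) (by positivity)

end Main

theorem theorem2 {F : Type*} [Field F] [Fintype F] (q n : ℕ) (hq : Fintype.card F = q)
    (hn : 3 ≤ n) :
    -- the lower bound, for every `q`: an equality for `n = 3`, and strict for `n ≥ 4`
    (n = 3 →
      (q : ℝ)⁻¹ ^ (n + 1) * (1 + ((n : ℝ) - 1) / 2 * (q : ℝ)⁻¹ - (q : ℝ)⁻¹ ^ 3)
        = (unc n F : ℝ) / (q : ℝ) ^ (n ^ 2)) ∧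
    (4 ≤ n →
      (q : ℝ)⁻¹ ^ (n + 1) * (1 + ((n : ℝ) - 1) / 2 * (q : ℝ)⁻¹ - (q : ℝ)⁻¹ ^ 3)
        < (unc n F : ℝ) / (q : ℝ) ^ (n ^ 2)) ∧
    -- the upper bounds
    (4 ≤ q →
      (unc n F : ℝ) / (q : ℝ) ^ (n ^ 2)
        < 2 * (q : ℝ)⁻¹ * ((q : ℝ)⁻¹ + (q : ℝ)⁻¹ ^ 2 + 2 * (q : ℝ)⁻¹ ^ 3) ^ n) ∧
    (q = 2 → (unc n F : ℝ) / (q : ℝ) ^ (n ^ 2) < 0.915 * 0.983 ^ n) ∧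
    (q = 3 → (unc n F : ℝ) / (q : ℝ) ^ (n ^ 2) < 0.52 * 0.53 ^ n) := by
  have hc : (q : ℝ) = Nat.card F := by rw [Nat.card_eq_fintype_card, hq]
  have hc' : Nat.card F = q := by rw [Nat.card_eq_fintype_card, hq]
  rw [hc]
  refine ⟨?_, lt_unc_div, fun h => unc_div_lt_of_four_le (hc'.symm ▸ h) (by omega),
    fun h => unc_div_lt_of_eq_two (hc'.trans h) (by omega),
    fun h => unc_div_lt_of_eq_three (hc'.trans h) (by omega)⟩
  rintro rfl
  rw [unc_three_div_eq]
  norm_num
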